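/- **Conventions.** A graded vector space is $L=\bigoplus_{i\in\mathbb Z}L_i$. An $L_\infty$-algebra is a graded vector space $L$ with graded skew-symmetric multilinear maps $l_k:L^{\otimes k}\to L$ of degree $2-k$ $(k\ge 1)$ such that for all $n\ge 1$ and homogeneous $x_1,\dots,x_n\in L$ $$\sum_{i+j=n+1}\ \sum_{\sigma\in Sh(i,n-i)}\chi(\sigma)(-1)^{i(j-1)}\,l_j\big(l_i(x_{\sigma(1)},\dots,x_{\sigma(i)}),x_{\sigma(i+1)},\dots,x_{\sigma(n)}\big)=0,$$ where $\chi(\sigma)=\mathrm{sgn}(\sigma)\varepsilon(\sigma)$ with $\varepsilon(\sigma)$ the Koszul sign. A compatible $L_\infty$-algebra $(L,\{l_k\},\{l'_k\})$ consists of two $L_\infty$-algebra structures on the same graded vector space $L$ such that for all $n\ge1$ and homogeneous $x_1,\dots,x_n\in L$ $$\sum_{i+j=n+1}\ \sum_{\sigma\in Sh(i,n-i)}\chi(\sigma)(-1)^{i(j-1)}\Big\{l_j\big(l'_i(x_{\sigma(1)},\dots,x_{\sigma(i)}),x_{\sigma(i+1)},\dots,x_{\sigma(n)}\big)+l'_j\big(l_i(x_{\sigma(1)},\dots,x_{\sigma(i)}),x_{\sigma(i+1)},\dots,x_{\sigma(n)}\big)\Big\}=0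 .$$ A Courant algebroid over a smooth manifold $M$ is a smooth real vector bundle $E\to M$ of finite rank with a smooth symmetric fibrewise nondegenerate pairing $\langle\,,\rangle$, an $\mathbb R$-bilinear bracket $[\,,]_E$ on $\Gamma E$ and a smooth bundle map $\rho:E\to TM$ such that for all $X,Y,Z\in\Gamma E$, $f\in C^\infty(M)$: - $[X,[Y,Z]_E]_E=[[X,Y]_E,Z]_E+[Y,[X,Z]_E]_E$, - $[X,fY]_E=f[X,Y]_E+\rho(X)(f)\,Y$, - $\rho[X,Y]_E=[\rho(X),\rho(Y)]$, - $[X,X]_E=\tfrac12\mathcal D\langle X,X\rangle$, - $\rho(X)\langle Y,Z\rangle=\langle[X,Y]_E,Z\rangle+\langle Y,[X,Z]_E\rangle$, where $\mathcal D:C^\infty(M)\to\Gamma E$ is determined by $\langle\mathcal Df,X\rangle=\rho(X)(f)$. The associated (Roytenberg–Weinstein) $L_\infty$-algebra is $L(E)=C^\infty(M)\oplus\Gamma E$, with $C^\infty(M)$ in degree $-1$, $\Gamma E$ in degree $0$, and $$l_1(f)=\mathcal Df,\qquad l_2(X,Y)=\lfloor X,Y\rfloor_E:=[X,Y]_E-\tfrac12\mathcal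 D\langle X,Y\rangle,\qquad l_2(X,f)=-l_2(f,X)=\tfrac12\langle X,\mathcal Df\rangle,$$ $$l_3(X,Y,Z)=-\tfrac16\big(\langle\lfloor X,Y\rfloor_E,Z\rangle+\langle\lfloor Y,Z\rfloor_E,X\rangle+\langle\lfloor Z,X\rfloor_E,Y\rangle\big),$$ all other components being zero. Two Courant algebroids $(E,\langle\,,\rangle,[\,,]_E,\rho)$ and $(E,\langle\,,\rangle,[\,,]'_E,\rho')$ on the same bundle with the same pairing are compatible if for all $X,Y,Z\in\Gamma E$ $$[X,[Y,Z]_E]'_E+[X,[Y,Z]'_E]_E=[[X,Y]_E,Z]'_E+[[X,Y]'_E,Z]_E+[Y,[X,Z]_E]'_E+[Y,[X,Z]'_E]_E,$$ $$\rho([X,Y]'_E)+\rho'([X,Y]_E)=[\rho(X),\rho'(Y)]+[\rho'(X),\rho(Y)];$$ equivalently, $(E,\langle\,,\rangle,[\,,]_E+[\,,]'_E,\rho+\rho')$ is again a Courant algebroid. **Proposition.** Let $(E,\langle\,,\rangle,[\,,]_E,\rho)$ and $(E,\langle\,,\rangle,[\,,]'_E,\rho')$ be two compatible Courant algebroids over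 a smooth manifold, and let $(l_1,l_2,l_3)$ and $(l'_1,l'_2,l'_3)$ be the structure maps on $L(E)=C^\infty(M)\oplus\Gamma E$ associated with them. Then $(L(E),\{l_1,l_2,l_3\},\{l'_1,l'_2,l'_3\})$ is a compatible $L_\infty$-algebra. -/

import Mathlib

/-! # Compatible Courant algebroids and compatible `L∞`-algebras -/

set_option linter.unusedSectionVars false

open Bundle Manifold
open scoped ContDiff Topology

/-! ## `L∞`-algebras -/

section LInfinity

/-- The permutation `σ` is an `(i, n - i)`-shuffle:
`σ 1 < ⋯ < σ i` and `σ (i+1) < ⋯ < σ n` (positions are counted from `0` in `Fin n`). -/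
def IsShuffle {n : ℕ} (i : ℕ) (σ : Equiv.Perm (Fin n)) : Prop :=
  (∀ p q : Fin n, p < q → (q : ℕ) < i → σ p < σ q) ∧
    (∀ p q : Fin n, p < q → i ≤ (p : ℕ) → σ p < σ q)

instance {n : ℕ} (i : ℕ) : DecidablePred (IsShuffle (n := n) i) := fun σ => by
  unfold IsShuffle; infer_instance

/-- The antisymmetric Koszul sign `χ(σ) = sgn(σ) ε(σ)`, where `ε(σ)` is the Koszul sign of the
rearrangement `x₁, …, xₙ ↦ x_{σ(1)}, …, x_{σ(n)}` of homogeneous elements of degrees `d`. -/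
def koszulChi {n : ℕ} (d : Fin n → ℤ) (σ : Equiv.Perm (Fin n)) : ℤˣ :=
  Equiv.Perm.sign σ *
    ∏ p : Fin n, ∏ q : Fin n,
      if p < q ∧ σ q < σ p then (d (σ p) * d (σ q)).negOnePow else 1

variable {K L : Type*} [Field K] [AddCommGroup L] [Module K L]

/-- The expression
`∑_{i+j=n+1} ∑_{σ ∈ Sh(i,n-i)} χ(σ) (-1)^{i(j-1)}
  l_j (l'_i (x_{σ(1)}, …, x_{σ(i)}), x_{σ(i+1)}, …, x_{σ(n)})`.
The summation variable is `a = i - 1`, so that `i = a + 1` and `j = (n - 1 - a) + 1`. -/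
def jacobiator (l l' : ∀ k : ℕ, MultilinearMap K (fun _ : Fin k => L) L)
    {n : ℕ} (d : Fin n → ℤ) (x : Fin n → L) : L :=
  ∑ a : Fin n, ∑ σ : Equiv.Perm (Fin n) with IsShuffle (a + 1) σ,
    (koszulChi d σ * (-1) ^ ((a + 1 : ℕ) * (n - 1 - a))) •
      l (n - 1 - a + 1)
        (Fin.cons
          (l' (a + 1) fun p : Fin (a + 1) => x (σ ⟨p, by omega⟩))
          fun q : Fin (n - 1 - a) => x (σ ⟨a + 1 + q, by omega⟩))

/-- `{l_k}_{k ≥ 1}` is an `L∞`-algebra structure on the graded vector space `L = ⨁ᵢ 𝒜 i`: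
each `l_k` is graded skew-symmetric of degree `2 - k`, and the higher Jacobi identities hold.
The entry `l 0` of the family plays no role. -/
structure IsLInfinityAlgebra (𝒜 : ℤ → Submodule K L)
    (l : ∀ k : ℕ, MultilinearMap K (fun _ : Fin k => L) L) : Prop where
  isInternal : DirectSum.IsInternal 𝒜
  degree : ∀ k : ℕ, 1 ≤ k → ∀ (d : Fin k → ℤ) (x : Fin k → L), (∀ i, x i ∈ 𝒜 (d i)) →
    l k x ∈ 𝒜 (∑ i, d i + (2 - k))
  skew : ∀ k : ℕ, 1 ≤ k → ∀ (d : Fin k → ℤ) (x : Fin k → L), (∀ i, x i ∈ 𝒜 (d i)) →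
    ∀ σ : Equiv.Perm (Fin k), l k (fun i => x (σ i)) = koszulChi d σ • l k x
  jacobi : ∀ n : ℕ, 1 ≤ n → ∀ (d : Fin n → ℤ) (x : Fin n → L), (∀ i, x i ∈ 𝒜 (d i)) →
    jacobiator l l d x = 0

/-- `(L, {l_k}, {l'_k})` is a compatible `L∞`-algebra: both families are `L∞`-algebra structures
and they satisfy the mixed higher Jacobi identities. -/
structure IsCompatibleLInfinityAlgebra (𝒜 : ℤ → Submodule K L)
    (l l' : ∀ k : ℕ, MultilinearMap K (fun _ : Fin k => L) L) : Prop where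
  left : IsLInfinityAlgebra 𝒜 l
  right : IsLInfinityAlgebra 𝒜 l'
  mixed : ∀ n : ℕ, 1 ≤ n → ∀ (d : Fin n → ℤ) (x : Fin n → L), (∀ i, x i ∈ 𝒜 (d i)) →
    jacobiator l l' d x + jacobiator l' l d x = 0

end LInfinity

/-! ## Courant algebroids -/

noncomputable section

section Courant

variable {EM : Type*} [NormedAddCommGroup EM] [NormedSpace ℝ EM]
  {M : Type*} [TopologicalSpace M] [ChartedSpace EM M]
  {F : Type*} [NormedAddCommGroup F] [NormedSpace ℝ F]
  {V : M → Type*} [TopologicalSpace (TotalSpace F V)] [∀ x, TopologicalSpace (V x)]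
  [∀ x, AddCommGroup (V x)] [∀ x, Module ℝ (V x)]
  [FiberBundle F V] [VectorBundle ℝ F V]

variable (EM F V) in
/-- A smooth symmetric fibrewise nondegenerate pairing on the vector bundle `V`. -/
structure BundlePairing where
  /-- The bilinear form on each fibre. -/
  toFun (x : M) : V x →L[ℝ] V x →L[ℝ] ℝ
  symm' (x : M) (v w : V x) : toFun x v w = toFun x w v
  nondegenerate' (x : M) (v : V x) (hv : ∀ w, toFun x v w = 0) : v = 0
  contMDiff' : ContMDiff 𝓘(ℝ, EM) (𝓘(ℝ, EM).prod 𝓘(ℝ, F →L[ℝ] F →L[ℝ] ℝ)) ∞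
    (fun x ↦ TotalSpace.mk' (F →L[ℝ] F →L[ℝ] ℝ) (E := fun x ↦ V x →L[ℝ] V x →L[ℝ] ℝ) x (toFun x))

/-- The product of a smooth function and a smooth section. -/
def funSmul (f : C^∞⟮𝓘(ℝ, EM), M; 𝓘(ℝ, ℝ), ℝ⟯) (X : Cₛ^∞⟮𝓘(ℝ, EM); F, V⟯) :
    Cₛ^∞⟮𝓘(ℝ, EM); F, V⟯ :=
  ⟨fun x => f x • X x, f.contMDiff.smul_section X.contMDiff⟩

namespace BundlePairing

variable (g : BundlePairing EM F V)

theorem contMDiffAt_apply {X Y : ∀ x, V x} {x₀ : M}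
    (hX : ContMDiffAt 𝓘(ℝ, EM) (𝓘(ℝ, EM).prod 𝓘(ℝ, F)) ∞ (fun x ↦ TotalSpace.mk' F x (X x)) x₀)
    (hY : ContMDiffAt 𝓘(ℝ, EM) (𝓘(ℝ, EM).prod 𝓘(ℝ, F)) ∞ (fun x ↦ TotalSpace.mk' F x (Y x)) x₀) :
    ContMDiffAt 𝓘(ℝ, EM) 𝓘(ℝ, ℝ) ∞ (fun x ↦ g.toFun x (X x) (Y x)) x₀ := by
  have h := ContMDiffAt.clm_bundle_apply₂ (F₁ := F) (F₂ := F) (F₃ := ℝ)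
    (E₃ := Bundle.Trivial M ℝ) (g.contMDiff' x₀) hX hY
  simpa [contMDiffAt_section] using h

/-- The pairing `⟨X, Y⟩ ∈ C^∞(M)` of two smooth sections. -/
def onSections : Cₛ^∞⟮𝓘(ℝ, EM); F, V⟯ →ₗ[ℝ] Cₛ^∞⟮𝓘(ℝ, EM); F, V⟯ →ₗ[ℝ]
    C^∞⟮𝓘(ℝ, EM), M; 𝓘(ℝ, ℝ), ℝ⟯ :=
  LinearMap.mk₂ ℝ
    (fun X Y => ⟨fun x => g.toFun x (X x) (Y x),
      fun x => g.contMDiffAt_apply (X.contMDiff x) (Y.contMDiff x)⟩)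
    (fun X X' Y => by ext x; simp; rfl) (fun c X Y => by ext x; simp; rfl)
    (fun X Y Y' => by ext x; simp; rfl) (fun c X Y => by ext x; simp; rfl)

/-- The pairing on a fibre, as a bilinear form. -/
def form (x : M) : LinearMap.BilinForm ℝ (V x) :=
  LinearMap.mk₂ ℝ (fun v w => g.toFun x v w) (by simp) (by simp) (by simp) (by simp)

theorem form_nondegenerate (x : M) : (g.form x).Nondegenerate :=
  ⟨fun v hv => g.nondegenerate' x v hv,
    fun v hv => g.nondegenerate' x v fun w => (g.symm' x v w).trans (hv w)⟩

end BundlePairing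

variable [IsManifold 𝓘(ℝ, EM) ∞ M]

variable (EM F V) in
/-- A smooth vector bundle map `V → TM` over the identity of `M`. -/
structure AnchorMap where
  /-- The linear map on each fibre. -/
  toFun (x : M) : V x →L[ℝ] TangentSpace 𝓘(ℝ, EM) x
  contMDiff' : ContMDiff 𝓘(ℝ, EM) (𝓘(ℝ, EM).prod 𝓘(ℝ, F →L[ℝ] EM)) ∞
    (fun x ↦ TotalSpace.mk' (F →L[ℝ] EM)
      (E := fun x ↦ V x →L[ℝ] TangentSpace 𝓘(ℝ, EM) x) x (toFun x))

namespace AnchorMap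

variable (ρ : AnchorMap EM F V)

/-- The vector field `ρ(X)` on `M`. -/
def vectorField (X : Cₛ^∞⟮𝓘(ℝ, EM); F, V⟯) : Π x : M, TangentSpace 𝓘(ℝ, EM) x :=
  fun x => ρ.toFun x (X x)

theorem contMDiffAt_apply (f : C^∞⟮𝓘(ℝ, EM), M; 𝓘(ℝ, ℝ), ℝ⟯) {X : ∀ x, V x} {x₀ : M}
    (hX : ContMDiffAt 𝓘(ℝ, EM) (𝓘(ℝ, EM).prod 𝓘(ℝ, F)) ∞ (fun x ↦ TotalSpace.mk' F x (X x)) x₀) :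
    ContMDiffAt 𝓘(ℝ, EM) 𝓘(ℝ, ℝ) ∞
      (fun x ↦ mvfderiv 𝓘(ℝ, EM) f x (ρ.toFun x (X x))) x₀ := by
  have h := ContMDiffAt.clm_bundle_apply (F₁ := F) (F₂ := EM) (ρ.contMDiff' x₀) hX
  have h2 := ((f.contMDiff.contMDiff_tangentMap (m := ∞) le_rfl).contMDiffAt.comp x₀ h)
  have h3 := (contMDiff_snd_tangentBundle_modelSpace (𝕜 := ℝ) ℝ 𝓘(ℝ, ℝ) (n := ∞)).contMDiffAt.comp x₀ h2
  exact h3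

/-- The derivative `ρ(X)(f) ∈ C^∞(M)` of a function along the vector field `ρ(X)`. -/
def lieDeriv (X : Cₛ^∞⟮𝓘(ℝ, EM); F, V⟯) (f : C^∞⟮𝓘(ℝ, EM), M; 𝓘(ℝ, ℝ), ℝ⟯) :
    C^∞⟮𝓘(ℝ, EM), M; 𝓘(ℝ, ℝ), ℝ⟯ :=
  ⟨fun x => mvfderiv 𝓘(ℝ, EM) f x (ρ.vectorField X x),
    fun x => ρ.contMDiffAt_apply f (X.contMDiff x)⟩

end AnchorMap

variable [FiniteDimensional ℝ F] [ContMDiffVectorBundle ∞ F V 𝓘(ℝ, EM)]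

theorem finiteDimensional_fiber (F : Type*) [NormedAddCommGroup F] [NormedSpace ℝ F]
    [TopologicalSpace (TotalSpace F V)] [FiberBundle F V] [VectorBundle ℝ F V]
    [FiniteDimensional ℝ F] (x : M) : FiniteDimensional ℝ (V x) :=
  ((trivializationAt F V x).linearEquivAt ℝ x
    (FiberBundle.mem_baseSet_trivializationAt' x)).symm.finiteDimensional

namespace BundlePairing

variable (g : BundlePairing EM F V) (ρ : AnchorMap EM F V)

/-- The value at `x` of `𝒟 f`: the vector of `V x` which corresponds, under the isomorphism
`V x ≃ (V x)*` induced by the pairing, to the covector `ρ* (d f) = d f ∘ ρ`. -/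
def gradAt (f : C^∞⟮𝓘(ℝ, EM), M; 𝓘(ℝ, ℝ), ℝ⟯) (x : M) : V x :=
  haveI := finiteDimensional_fiber (V := V) F x
  ((g.form x).toDual (g.form_nondegenerate x)).symm
    ((mvfderiv 𝓘(ℝ, EM) f x).comp (ρ.toFun x)).toLinearMap

theorem gradAt_spec (f : C^∞⟮𝓘(ℝ, EM), M; 𝓘(ℝ, ℝ), ℝ⟯) (x : M) (v : V x) :
    g.toFun x (g.gradAt ρ f x) v = mvfderiv 𝓘(ℝ, EM) f x (ρ.toFun x v) := by
  have := finiteDimensional_fiber (V := V) F x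
  exact LinearMap.BilinForm.apply_toDual_symm_apply (B := g.form x)
    (hB := g.form_nondegenerate x) ((mvfderiv 𝓘(ℝ, EM) f x).comp (ρ.toFun x)).toLinearMap v

theorem eq_gradAt (f : C^∞⟮𝓘(ℝ, EM), M; 𝓘(ℝ, ℝ), ℝ⟯) (x : M) (u : V x)
    (hu : ∀ v, g.toFun x u v = mvfderiv 𝓘(ℝ, EM) f x (ρ.toFun x v)) : u = g.gradAt ρ f x := by
  rw [← sub_eq_zero]
  refine g.nondegenerate' x _ fun v => ?_
  simp [hu v, g.gradAt_spec ρ f x v]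

theorem contMDiffAt_det {n : ℕ} {A : M → Matrix (Fin n) (Fin n) ℝ} {x₀ : M}
    (hA : ∀ i j, ContMDiffAt 𝓘(ℝ, EM) 𝓘(ℝ, ℝ) ∞ (fun x => A x i j) x₀) :
    ContMDiffAt 𝓘(ℝ, EM) 𝓘(ℝ, ℝ) ∞ (fun x => (A x).det) x₀ := by
  simp only [Matrix.det_apply']
  exact contMDiffAt_finsetSum fun σ _ =>
    contMDiffAt_const.mul (contMDiffAt_finsetProd fun i _ => hA _ _)

theorem contMDiffAt_inv {n : ℕ} {A : M → Matrix (Fin n) (Fin n) ℝ} {x₀ : M}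
    (hA : ∀ i j, ContMDiffAt 𝓘(ℝ, EM) 𝓘(ℝ, ℝ) ∞ (fun x => A x i j) x₀)
    (h0 : (A x₀).det ≠ 0) (i j : Fin n) :
    ContMDiffAt 𝓘(ℝ, EM) 𝓘(ℝ, ℝ) ∞ (fun x => (A x)⁻¹ i j) x₀ := by
  simp only [Matrix.inv_def, Matrix.smul_apply, smul_eq_mul, Ring.inverse_eq_inv',
    Matrix.adjugate_apply]
  refine ((contMDiffAt_det hA).inv₀ h0).mul (contMDiffAt_det fun k l => ?_)
  by_cases hk : k = j
  · subst hk
    simpa using contMDiffAt_const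
  · simpa [Matrix.updateRow_ne hk] using hA k l

theorem contMDiff_gradAt (f : C^∞⟮𝓘(ℝ, EM), M; 𝓘(ℝ, ℝ), ℝ⟯) :
    ContMDiff 𝓘(ℝ, EM) (𝓘(ℝ, EM).prod 𝓘(ℝ, F)) ∞
      (fun x ↦ TotalSpace.mk' F x (g.gradAt ρ f x)) := by
  intro x₀
  let e := trivializationAt F V x₀
  have hx₀ : x₀ ∈ e.baseSet := FiberBundle.mem_baseSet_trivializationAt' x₀
  let b := Module.finBasis ℝ F
  let s := e.localFrame b
  have hs : ∀ i, ContMDiffAt 𝓘(ℝ, EM) (𝓘(ℝ, EM).prod 𝓘(ℝ, F)) ∞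
      (fun x ↦ TotalSpace.mk' F x (s i x)) x₀ := fun i => contMDiffAt_localFrame_of_mem ∞ e b i hx₀
  let G : M → Matrix _ _ ℝ := fun x => Matrix.of fun i j => g.toFun x (s i x) (s j x)
  let h : M → _ → ℝ := fun x i => mvfderiv 𝓘(ℝ, EM) f x (ρ.toFun x (s i x))
  have hdet : ∀ x ∈ e.baseSet, (G x).det ≠ 0 := by
    intro x hx
    have := (LinearMap.BilinForm.nondegenerate_iff_det_ne_zero (e.basisAt b hx)).1
      (g.form_nondegenerate x)
    have hGx : G x = LinearMap.BilinForm.toMatrix (e.basisAt b hx) (g.form x) := by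
      ext i j
      simp [G, s, form, hx, LinearMap.BilinForm.toMatrix_apply]
    rw [hGx]
    exact this
  have hG : ∀ i j, ContMDiffAt 𝓘(ℝ, EM) 𝓘(ℝ, ℝ) ∞ (fun x => G x i j) x₀ :=
    fun i j => g.contMDiffAt_apply (hs i) (hs j)
  have hh : ∀ i, ContMDiffAt 𝓘(ℝ, EM) 𝓘(ℝ, ℝ) ∞ (fun x => h x i) x₀ :=
    fun i => ρ.contMDiffAt_apply f (hs i)
  have key : ContMDiffAt 𝓘(ℝ, EM) (𝓘(ℝ, EM).prod 𝓘(ℝ, F)) ∞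
      (fun x ↦ TotalSpace.mk' F x (∑ i, ((G x)⁻¹.mulVec (h x) i) • s i x)) x₀ := by
    refine ContMDiffAt.sum_section (t := fun i x => ((G x)⁻¹.mulVec (h x) i) • s i x)
      fun i _ => ContMDiffAt.smul_section ?_ (hs i)
    simp only [Matrix.mulVec, dotProduct]
    exact contMDiffAt_finsetSum fun j _ =>
      (contMDiffAt_inv hG (hdet x₀ hx₀) i j).mul (hh j)
  refine key.congr_of_eventuallyEq ?_
  filter_upwards [e.open_baseSet.mem_nhds hx₀] with x hx
  congr 1
  symm
  refine g.eq_gradAt ρ f x _ fun v => ?_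
  have hlin : g.form x (∑ i, ((G x)⁻¹.mulVec (h x) i) • s i x) =
      ((mvfderiv 𝓘(ℝ, EM) f x).comp (ρ.toFun x)).toLinearMap := by
    refine (e.basisAt b hx).ext fun j => ?_
    have hj : e.basisAt b hx j = s j x := by simp [s, hx]
    rw [hj]
    have : (G x).mulVec ((G x)⁻¹.mulVec (h x)) j = h x j := by
      rw [Matrix.mulVec_mulVec, Matrix.mul_nonsing_inv _ (isUnit_iff_ne_zero.2 (hdet x hx)),
        Matrix.one_mulVec]
    refine Eq.trans ?_ this
    simp only [map_sum, map_smul, LinearMap.sum_apply, LinearMap.smul_apply, smul_eq_mul]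
    rw [Matrix.mulVec, dotProduct]
    refine Finset.sum_congr rfl fun i _ => ?_
    rw [mul_comm]
    exact congrArg (· * _) (g.symm' x _ _)
  exact LinearMap.congr_fun hlin v

/-- The operator `𝒟 : C^∞(M) → Γ(V)`, the composition
`C^∞(M) → Ω¹(M) → Γ(V*) ≃ Γ(V)` of `d`, `ρ*` and the isomorphism induced by the pairing. -/
def dOp : C^∞⟮𝓘(ℝ, EM), M; 𝓘(ℝ, ℝ), ℝ⟯ →ₗ[ℝ] Cₛ^∞⟮𝓘(ℝ, EM); F, V⟯ where
  toFun f := ⟨g.gradAt ρ f, g.contMDiff_gradAt ρ f⟩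
  map_add' f f' := by
    ext x
    refine (g.eq_gradAt ρ (f + f') x (g.gradAt ρ f x + g.gradAt ρ f' x) fun v => ?_).symm
    have := mvfderiv_add (I := 𝓘(ℝ, EM)) (f.mdifferentiableAt (x := x))
      (f'.mdifferentiableAt (x := x))
    rw [ContMDiffMap.coe_add, this]
    simp [gradAt_spec]
  map_smul' c f := by
    ext x
    refine (g.eq_gradAt ρ (c • f) x (c • g.gradAt ρ f x) fun v => ?_).symm
    have := mvfderiv_smul (I := 𝓘(ℝ, EM)) (x := x) (mdifferentiableAt_const (c := c))
      (f.mdifferentiableAt (x := x))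
    rw [ContMDiffMap.coe_smul]
    have h2 : (c • (f : M → ℝ)) = (fun _ : M => c) • (f : M → ℝ) := rfl
    rw [h2, this, mvfderiv_const]
    simp [gradAt_spec]

end BundlePairing

/-- A Courant algebroid structure on the vector bundle `V` with the pairing `g`. -/
structure CourantAlgebroid (g : BundlePairing EM F V) where
  /-- The bracket `[X, Y]` of sections, bilinear over `ℝ`. -/
  bracket : Cₛ^∞⟮𝓘(ℝ, EM); F, V⟯ →ₗ[ℝ] Cₛ^∞⟮𝓘(ℝ, EM); F, V⟯ →ₗ[ℝ] Cₛ^∞⟮𝓘(ℝ, EM); F, V⟯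
  /-- The anchor `ρ : V → TM`. -/
  anchor : AnchorMap EM F V
  left_leibniz (X Y Z : Cₛ^∞⟮𝓘(ℝ, EM); F, V⟯) :
    bracket X (bracket Y Z) = bracket (bracket X Y) Z + bracket Y (bracket X Z)
  bracket_funSmul (X Y : Cₛ^∞⟮𝓘(ℝ, EM); F, V⟯) (f : C^∞⟮𝓘(ℝ, EM), M; 𝓘(ℝ, ℝ), ℝ⟯) :
    bracket X (funSmul f Y) = funSmul f (bracket X Y) + funSmul (anchor.lieDeriv X f) Y
  anchor_bracket (X Y : Cₛ^∞⟮𝓘(ℝ, EM); F, V⟯) :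
    anchor.vectorField (bracket X Y) =
      VectorField.mlieBracket 𝓘(ℝ, EM) (anchor.vectorField X) (anchor.vectorField Y)
  bracket_self (X : Cₛ^∞⟮𝓘(ℝ, EM); F, V⟯) :
    bracket X X = (1 / 2 : ℝ) • g.dOp anchor (g.onSections X X)
  anchor_pairing (X Y Z : Cₛ^∞⟮𝓘(ℝ, EM); F, V⟯) :
    anchor.lieDeriv X (g.onSections Y Z) =
      g.onSections (bracket X Y) Z + g.onSections Y (bracket X Z)

namespace CourantAlgebroid

variable {g : BundlePairing EM F V}

/-- Two Courant algebroids on the same vector bundle and with the same pairing are compatible. -/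
structure Compatible (C C' : CourantAlgebroid g) : Prop where
  bracket (X Y Z : Cₛ^∞⟮𝓘(ℝ, EM); F, V⟯) :
    C'.bracket X (C.bracket Y Z) + C.bracket X (C'.bracket Y Z) =
      C'.bracket (C.bracket X Y) Z + C.bracket (C'.bracket X Y) Z +
        C'.bracket Y (C.bracket X Z) + C.bracket Y (C'.bracket X Z)
  anchor (X Y : Cₛ^∞⟮𝓘(ℝ, EM); F, V⟯) :
    C.anchor.vectorField (C'.bracket X Y) + C'.anchor.vectorField (C.bracket X Y) =
      VectorField.mlieBracket 𝓘(ℝ, EM) (C.anchor.vectorField X) (C'.anchor.vectorField Y) +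
        VectorField.mlieBracket 𝓘(ℝ, EM) (C'.anchor.vectorField X) (C.anchor.vectorField Y)

/-! ### The associated `L∞`-algebra on `C^∞(M) ⊕ Γ(V)` -/

variable (EM F V) in
/-- The total space `C^∞(M) ⊕ Γ(V)` of the associated `L∞`-algebra. -/
abbrev LSpace : Type _ := C^∞⟮𝓘(ℝ, EM), M; 𝓘(ℝ, ℝ), ℝ⟯ × Cₛ^∞⟮𝓘(ℝ, EM); F, V⟯

variable (EM F V) in
/-- The grading of `C^∞(M) ⊕ Γ(V)`: functions have degree `-1` and sections have degree `0`. -/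
def grading (i : ℤ) : Submodule ℝ (LSpace EM F V) :=
  if i = -1 then LinearMap.range (LinearMap.inl ℝ _ _)
  else if i = 0 then LinearMap.range (LinearMap.inr ℝ _ _)
  else ⊥

variable (C : CourantAlgebroid g)

/-- The operator `𝒟 : C^∞(M) → Γ(V)` of the Courant algebroid. -/
def D : C^∞⟮𝓘(ℝ, EM), M; 𝓘(ℝ, ℝ), ℝ⟯ →ₗ[ℝ] Cₛ^∞⟮𝓘(ℝ, EM); F, V⟯ :=
  g.dOp C.anchor

/-- The skew-symmetrized bracket `⌊X, Y⌋ = [X, Y] - ½ 𝒟 ⟨X, Y⟩`. -/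
def skewBracket :
    Cₛ^∞⟮𝓘(ℝ, EM); F, V⟯ →ₗ[ℝ] Cₛ^∞⟮𝓘(ℝ, EM); F, V⟯ →ₗ[ℝ] Cₛ^∞⟮𝓘(ℝ, EM); F, V⟯ :=
  C.bracket - (1 / 2 : ℝ) • g.onSections.compr₂ C.D

/-- `l₁(f) = 𝒟 f`, extended by zero to sections. -/
def l₁ : MultilinearMap ℝ (fun _ : Fin 1 => LSpace EM F V) (LSpace EM F V) where
  toFun u := (0, C.D (u 0).1)
  map_update_add' u i a b := by
    rw [Subsingleton.elim i 0]; simp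
  map_update_smul' u i c a := by
    rw [Subsingleton.elim i 0]; simp

/-- `l₂(X, Y) = ⌊X, Y⌋`, `l₂(X, f) = - l₂(f, X) = ½ ⟨X, 𝒟 f⟩` and `l₂(f, f') = 0`. -/
def l₂ : MultilinearMap ℝ (fun _ : Fin 2 => LSpace EM F V) (LSpace EM F V) where
  toFun u :=
    ((1 / 2 : ℝ) • g.onSections (u 0).2 (C.D (u 1).1)
        - (1 / 2 : ℝ) • g.onSections (u 1).2 (C.D (u 0).1),
      C.skewBracket (u 0).2 (u 1).2)
  map_update_add' u i a b := by
    fin_cases i <;> simp [Function.update, smul_add] <;> abel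
  map_update_smul' u i c a := by
    fin_cases i <;> simp [Function.update, smul_sub, smul_comm c]

/-- `l₃(X, Y, Z) = - (1/6) (⟨⌊X, Y⌋, Z⟩ + ⟨⌊Y, Z⌋, X⟩ + ⟨⌊Z, X⌋, Y⟩)`, and `l₃` vanishes if one of
its arguments is a function. -/
def l₃ : MultilinearMap ℝ (fun _ : Fin 3 => LSpace EM F V) (LSpace EM F V) where
  toFun u :=
    (-(1 / 6 : ℝ) • (g.onSections (C.skewBracket (u 0).2 (u 1).2) (u 2).2
        + g.onSections (C.skewBracket (u 1).2 (u 2).2) (u 0).2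
        + g.onSections (C.skewBracket (u 2).2 (u 0).2) (u 1).2), 0)
  map_update_add' := by
    intro inst u i a b
    obtain rfl := Subsingleton.elim inst (instDecidableEqFin 3)
    fin_cases i <;> simp [Function.update, smul_add] <;> abel
  map_update_smul' := by
    intro inst u i c a
    obtain rfl := Subsingleton.elim inst (instDecidableEqFin 3)
    fin_cases i <;> simp [Function.update, smul_add, smul_comm c]

/-- The structure maps of the `L∞`-algebra associated to a Courant algebroid. -/
def structureMaps (k : ℕ) : MultilinearMap ℝ (fun _ : Fin k => LSpace EM F V) (LSpace EM F V) :=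
  match k with
  | 1 => C.l₁
  | 2 => C.l₂
  | 3 => C.l₃
  | _ => 0

end CourantAlgebroid

end Courant

end

/-! The jacobiator `jacobiator l l'` is linear in the outer family and in the inner one, so it is a
quadratic expression whose polarisation is the mixed identity: `jacobiator_add` says that the
jacobiator of `l + l'` is the sum of those of `l` and `l'` and the mixed terms. Compatibility makes
the sum of the two brackets and anchors a Courant algebroid again (`CourantAlgebroid.add`). Since
the pairing is fixed and `D` is additive in the anchor, its structure maps are `l + l'`
(`structureMaps_add`). The mixed identity thus follows from the Roytenberg–Weinstein theorem for
`C`, `C'` and their sum.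

That theorem (`isLInfinityAlgebra`) is proved from the identities collected in `IsCourantDorfman`.
The two that are not axioms are `bracket_D_left`, which tests `[D f, X]` against all sections, and
`onSections_D_D`, which comes from the Leibniz rule for products of functions. The rest is algebra.
For n = 3, the Jacobiator of the skew bracket is `D` of a multiple of the cyclic sum
(`skewBr_jacobi`), with `cyc_D_left` for one function argument. For n = 4, the identity is
`cyc_jacobi`, which rests on the Leibniz identity paired with a fourth section. The other identities
are short or hold for degree reasons. -/

/-! ### Vector fields as derivations: the Lie bracket is the commutator. -/

namespace VectorField

section

variable {E : Type*} [NormedAddCommGroup E] [NormedSpace ℝ E]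
  {M : Type*} [TopologicalSpace M] [ChartedSpace E M] [IsManifold 𝓘(ℝ, E) ∞ M]

/-- In a chart, the derivative of a function along a vector field is computed by the pullbacks of
the function and of the vector field. -/
theorem fderiv_comp_extChartAt_symm_mpullbackWithin {f : M → ℝ} (x₀ : M) {y : E}
    (hy : y ∈ (extChartAt 𝓘(ℝ, E) x₀).target)
    (hf : MDifferentiableAt 𝓘(ℝ, E) 𝓘(ℝ, ℝ) f ((extChartAt 𝓘(ℝ, E) x₀).symm y))
    (V : Π x : M, TangentSpace 𝓘(ℝ, E) x) :
    fderiv ℝ (f ∘ (extChartAt 𝓘(ℝ, E) x₀).symm) y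
        (mpullbackWithin 𝓘(ℝ, E) 𝓘(ℝ, E) (extChartAt 𝓘(ℝ, E) x₀).symm V
          (Set.range 𝓘(ℝ, E)) y) =
      mvfderiv 𝓘(ℝ, E) f ((extChartAt 𝓘(ℝ, E) x₀).symm y)
        (V ((extChartAt 𝓘(ℝ, E) x₀).symm y)) := by
  have hi := isInvertible_mfderivWithin_extChartAt_symm (I := 𝓘(ℝ, E)) hy
  have hs := mdifferentiableWithinAt_extChartAt_symm (I := 𝓘(ℝ, E)) hy
  rw [mpullbackWithin_apply]
  simp only [modelWithCornersSelf_coe, Set.range_id, mfderivWithin_univ,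
    mdifferentiableWithinAt_univ] at hi hs ⊢
  have h1 := mvfderiv_comp_apply y hf hs
    ((mfderiv 𝓘(ℝ, E) 𝓘(ℝ, E) (extChartAt 𝓘(ℝ, E) x₀).symm y).inverse
      (V ((extChartAt 𝓘(ℝ, E) x₀).symm y)))
  have h2 := hi.self_apply_inverse (V ((extChartAt 𝓘(ℝ, E) x₀).symm y))
  rw [h2] at h1
  rw [← h1, mvfderiv, mfderiv_eq_fderiv]
  rfl

/-- The Lie bracket of vector fields acts on functions as the commutator of derivations. -/
theorem mvfderiv_mlieBracket [CompleteSpace E] {f : M → ℝ}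
    (hf : ContMDiff 𝓘(ℝ, E) 𝓘(ℝ, ℝ) ∞ f) {V W : Π x : M, TangentSpace 𝓘(ℝ, E) x} {x₀ : M}
    (hV : MDifferentiableAt 𝓘(ℝ, E) 𝓘(ℝ, E).tangent
      (fun x ↦ (V x : TangentBundle 𝓘(ℝ, E) M)) x₀)
    (hW : MDifferentiableAt 𝓘(ℝ, E) 𝓘(ℝ, E).tangent
      (fun x ↦ (W x : TangentBundle 𝓘(ℝ, E) M)) x₀)
    (hfV : MDifferentiableAt 𝓘(ℝ, E) 𝓘(ℝ, ℝ) (fun x ↦ mvfderiv 𝓘(ℝ, E) f x (V x)) x₀)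
    (hfW : MDifferentiableAt 𝓘(ℝ, E) 𝓘(ℝ, ℝ) (fun x ↦ mvfderiv 𝓘(ℝ, E) f x (W x)) x₀) :
    mvfderiv 𝓘(ℝ, E) f x₀ (mlieBracket 𝓘(ℝ, E) V W x₀) =
      mvfderiv 𝓘(ℝ, E) (fun x ↦ mvfderiv 𝓘(ℝ, E) f x (W x)) x₀ (V x₀) -
        mvfderiv 𝓘(ℝ, E) (fun x ↦ mvfderiv 𝓘(ℝ, E) f x (V x)) x₀ (W x₀) := by
  have : IsManifold 𝓘(ℝ, E) 2 M := .of_le (n := ∞) (by norm_cast)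
  let ψ := (extChartAt 𝓘(ℝ, E) x₀).symm
  let y₀ := extChartAt 𝓘(ℝ, E) x₀ x₀
  have hy₀ : y₀ ∈ (extChartAt 𝓘(ℝ, E) x₀).target := mem_extChartAt_target x₀
  have hx₀ : ψ y₀ = x₀ := extChartAt_to_inv x₀
  have hfd : ∀ x, MDifferentiableAt 𝓘(ℝ, E) 𝓘(ℝ, ℝ) f x :=
    fun x => (hf x).mdifferentiableAt (by simp)
  let V' : E → E := mpullbackWithin 𝓘(ℝ, E) 𝓘(ℝ, E) ψ V (Set.range 𝓘(ℝ, E))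
  let W' : E → E := mpullbackWithin 𝓘(ℝ, E) 𝓘(ℝ, E) ψ W (Set.range 𝓘(ℝ, E))
  have hset : ψ ⁻¹' Set.univ ∩ Set.range 𝓘(ℝ, E) = Set.univ := by simp
  have hV' : DifferentiableAt ℝ V' y₀ := by
    have := (mdifferentiableWithinAt_univ.2 hV).differentiableWithinAt_mpullbackWithin_vectorField
    rw [hset] at this
    exact differentiableWithinAt_univ.1 this
  have hW' : DifferentiableAt ℝ W' y₀ := by
    have := (mdifferentiableWithinAt_univ.2 hW).differentiableWithinAt_mpullbackWithin_vectorField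
    rw [hset] at this
    exact differentiableWithinAt_univ.1 this
  have hF : ContDiffAt ℝ ∞ (f ∘ ψ) y₀ := by
    have h1 := contMDiffOn_extChartAt_symm (I := 𝓘(ℝ, E)) (n := ∞) x₀
    have h2 := h1.contMDiffAt (extChartAt_target_mem_nhds x₀)
    exact ((hf _).comp y₀ h2).contDiffAt
  -- An equality of germs is needed, because both sides are differentiated at `y₀` below.
  have key : ∀ Z : Π x : M, TangentSpace 𝓘(ℝ, E) x,
      (fun y => fderiv ℝ (f ∘ ψ) y
        (mpullbackWithin 𝓘(ℝ, E) 𝓘(ℝ, E) ψ Z (Set.range 𝓘(ℝ, E)) y)) =ᶠ[𝓝 y₀]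
        (fun x ↦ mvfderiv 𝓘(ℝ, E) f x (Z x)) ∘ ψ := by
    intro Z
    filter_upwards [extChartAt_target_mem_nhds (I := 𝓘(ℝ, E)) x₀] with y hy
    exact fderiv_comp_extChartAt_symm_mpullbackWithin x₀ hy (hfd _) Z
  have main := fderiv_apply_lieBracket hF (n := ∞) (by simp; norm_cast) hW' hV'
  rw [(key W).fderiv_eq, (key V).fderiv_eq] at main
  have e1 := fderiv_comp_extChartAt_symm_mpullbackWithin x₀ hy₀
    (f := fun x ↦ mvfderiv 𝓘(ℝ, E) f x (W x)) (by rw [hx₀]; exact hfW) V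
  have e2 := fderiv_comp_extChartAt_symm_mpullbackWithin x₀ hy₀
    (f := fun x ↦ mvfderiv 𝓘(ℝ, E) f x (V x)) (by rw [hx₀]; exact hfV) W
  rw [hx₀] at e1 e2
  -- The manifold bracket is the chart bracket pulled back by the inverse of this derivative, which
  -- therefore cancels.
  have hi := isInvertible_mfderiv_extChartAt (I := 𝓘(ℝ, E)) (mem_extChartAt_source x₀)
  have hbr : mfderiv 𝓘(ℝ, E) 𝓘(ℝ, E) (extChartAt 𝓘(ℝ, E) x₀) x₀ (mlieBracket 𝓘(ℝ, E) V W x₀) =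
      lieBracket ℝ V' W' y₀ := by
    rw [← mlieBracketWithin_univ, mlieBracketWithin_apply]
    refine (hi.self_apply_inverse _).trans ?_
    rw [hset]
    exact congrFun lieBracketWithin_univ y₀
  have hloc : f =ᶠ[𝓝 x₀] (f ∘ ψ) ∘ extChartAt 𝓘(ℝ, E) x₀ := by
    filter_upwards [extChartAt_source_mem_nhds (I := 𝓘(ℝ, E)) x₀] with x hx
    exact congrArg f ((extChartAt 𝓘(ℝ, E) x₀).left_inv hx).symm
  have e3 : mvfderiv 𝓘(ℝ, E) f x₀ (mlieBracket 𝓘(ℝ, E) V W x₀) =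
      fderiv ℝ (f ∘ ψ) y₀ (lieBracket ℝ V' W' y₀) := by
    have h1 := mvfderiv_comp_apply x₀ (g := f ∘ ψ) (f := extChartAt 𝓘(ℝ, E) x₀)
      (hF.differentiableAt (by simp)).mdifferentiableAt
      (mdifferentiableAt_extChartAt (mem_chart_source E x₀)) (mlieBracket 𝓘(ℝ, E) V W x₀)
    rw [hbr] at h1
    have h2 : mvfderiv 𝓘(ℝ, E) f x₀ = mvfderiv 𝓘(ℝ, E) ((f ∘ ψ) ∘ extChartAt 𝓘(ℝ, E) x₀) x₀ := by
      ext v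
      exact congrArg (fun L : TangentSpace 𝓘(ℝ, E) x₀ →L[ℝ] ℝ => L v) hloc.mfderiv_eq
    rw [h2, h1, mvfderiv, mfderiv_eq_fderiv]
    rfl
  rw [e3]
  exact main.trans (congrArg₂ (· - ·) e1 e2)

end
end VectorField

/-! ### Algebraic identities of pairing, `D` and Dorfman bracket. -/

section CourantDorfman

variable {A E : Type*} [AddCommGroup A] [Module ℝ A] [AddCommGroup E] [Module ℝ E]

/-- The part of the algebraic structure on the functions `A` and the sections `E` of a Courant
algebroid that does not involve products of functions: a symmetric pairing `P`, an operator `D`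
and a Dorfman bracket `br`. -/
structure IsCourantDorfman (P : E →ₗ[ℝ] E →ₗ[ℝ] A) (D : A →ₗ[ℝ] E)
    (br : E →ₗ[ℝ] E →ₗ[ℝ] E) : Prop where
  pairing_comm (X Y : E) : P X Y = P Y X
  leibniz (X Y Z : E) : br X (br Y Z) = br (br X Y) Z + br Y (br X Z)
  bracket_swap (X Y : E) : br Y X = D (P X Y) - br X Y
  invariant (X Y Z : E) : P X (D (P Y Z)) = P (br X Y) Z + P Y (br X Z)
  bracket_D_left (f : A) (X : E) : br (D f) X = 0
  pairing_D_D (f h : A) : P (D f) (D h) = 0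

namespace IsCourantDorfman

variable {P : E →ₗ[ℝ] E →ₗ[ℝ] A} {D : A →ₗ[ℝ] E} {br : E →ₗ[ℝ] E →ₗ[ℝ] E}

/-- The skew-symmetrized bracket. -/
noncomputable def skewBr (P : E →ₗ[ℝ] E →ₗ[ℝ] A) (D : A →ₗ[ℝ] E) (br : E →ₗ[ℝ] E →ₗ[ℝ] E) (X Y : E) : E :=
  br X Y - (1 / 2 : ℝ) • D (P X Y)

/-- The cyclic sum `⟨⌊X, Y⌋, Z⟩ + ⟨⌊Y, Z⌋, X⟩ + ⟨⌊Z, X⌋, Y⟩`. -/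
noncomputable def cyc (P : E →ₗ[ℝ] E →ₗ[ℝ] A) (D : A →ₗ[ℝ] E) (br : E →ₗ[ℝ] E →ₗ[ℝ] E) (X Y Z : E) : A :=
  P (skewBr P D br X Y) Z + P (skewBr P D br Y Z) X + P (skewBr P D br Z X) Y

variable (h : IsCourantDorfman P D br)
include h

theorem bracket_D_right (X : E) (f : A) : br X (D f) = D (P X (D f)) := by
  rw [h.bracket_swap (D f) X, h.bracket_D_left, sub_zero, h.pairing_comm]

/-- Invariance with `D f` in the last slot. As `P X (D f)` stands for the derivative of `f` along
the anchor of `X`, this recovers the compatibility of the anchor with brackets, which is not a field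
of `IsCourantDorfman`. -/
theorem pairing_bracket_D (X Y : E) (f : A) :
    P (br X Y) (D f) = P X (D (P Y (D f))) - P Y (D (P X (D f))) := by
  rw [h.invariant X Y (D f), h.bracket_D_right, add_sub_cancel_right]

theorem skewBr_swap (X Y : E) : skewBr P D br Y X = - skewBr P D br X Y := by
  simp only [skewBr, h.bracket_swap X Y, h.pairing_comm Y X]
  module

/-- Together with `pairing_bracket_rotate` this gives a normal form: every pairing of a bracket of
two of three sections with the third becomes a multiple of `P (br X Y) Z` plus derivatives of
pairings. -/
theorem pairing_bracket_right (X Y Z : E) :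
    P (br X Z) Y = P X (D (P Y Z)) - P (br X Y) Z := by
  rw [h.invariant, h.pairing_comm Y, add_sub_cancel_left]

theorem pairing_bracket_rotate (X Y Z : E) :
    P (br Y Z) X = P (br X Y) Z - P Z (D (P X Y)) + P Y (D (P X Z)) := by
  rw [h.pairing_bracket_right Y X Z, h.bracket_swap X Y, map_sub, LinearMap.sub_apply,
    h.pairing_comm (D _)]
  abel

/-- The cyclic sum in terms of the Dorfman bracket. -/
theorem cyc_eq (X Y Z : E) :
    cyc P D br X Y Z = (3 : ℝ) • P (br X Y) Z +
      (3 / 2 : ℝ) • (P Y (D (P X Z)) - P X (D (P Y Z)) - P Z (D (P X Y))) := by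
  simp only [cyc, skewBr, map_sub, map_smul, LinearMap.sub_apply, LinearMap.smul_apply,
    h.pairing_bracket_rotate Y Z X, h.pairing_bracket_rotate X Y Z, h.pairing_comm (D _),
    h.pairing_comm Z X, h.pairing_comm Y X]
  module

theorem cyc_swap (X Y Z : E) : cyc P D br Y X Z = - cyc P D br X Y Z := by
  simp only [cyc, h.skewBr_swap X Y, h.skewBr_swap Z X, h.skewBr_swap Y Z, map_neg,
    LinearMap.neg_apply]
  abel

omit h in
theorem cyc_rotate (X Y Z : E) : cyc P D br Y Z X = cyc P D br X Y Z := by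
  simp only [cyc]
  abel

/-- The Jacobiator of the skew-symmetrized bracket is exact. -/
theorem skewBr_jacobi (X Y Z : E) :
    skewBr P D br (skewBr P D br X Y) Z - skewBr P D br (skewBr P D br X Z) Y +
      skewBr P D br (skewBr P D br Y Z) X = (1 / 6 : ℝ) • D (cyc P D br X Y Z) := by
  rw [h.cyc_eq]
  simp only [skewBr, map_sub, map_smul, LinearMap.sub_apply, LinearMap.smul_apply,
    h.bracket_D_left, h.pairing_comm (D _), map_add]
  -- Swapping two outer brackets puts the nested brackets in the shape of the Leibniz identity,
  -- which cancels them; only terms in the image of `D` remain.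
  rw [h.bracket_swap Y (br X Z), h.bracket_swap X (br Y Z), h.leibniz X Y Z,
    h.pairing_comm Y (br X Z), h.pairing_comm X (br Y Z), h.pairing_bracket_right X Y Z,
    h.pairing_bracket_rotate X Y Z]
  simp only [map_sub, map_add]
  module

/-- In the normal form `cyc_eq` the derivative terms form a commutator that cancels half of `3 P (br
X Y) (D f)`. This handles the third Jacobi identity with one function argument. -/
theorem cyc_D_left (f : A) (X Y : E) :
    cyc P D br (D f) X Y = (3 / 2 : ℝ) • P (br X Y) (D f) := by
  rw [← cyc_rotate, h.cyc_eq, h.pairing_bracket_D, h.pairing_D_D]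
  module

theorem pairing_skewBr_D (X Y : E) (f : A) :
    P (skewBr P D br X Y) (D f) = P X (D (P Y (D f))) - P Y (D (P X (D f))) := by
  simp only [skewBr, map_sub, map_smul, LinearMap.sub_apply, LinearMap.smul_apply,
    h.pairing_D_D, h.pairing_bracket_D, smul_zero, sub_zero]

/-- Rotating the nested bracket into the last slot before applying `cyc_eq` leaves a single product
of two brackets; everything else is a derivative of a pairing. -/
theorem cyc_skewBr (X Y Z W : E) :
    cyc P D br (skewBr P D br X Y) Z W = (3 : ℝ) • P (br X Y) (br Z W) +
      (3 / 2 : ℝ) • (P W (D (P (br X Y) Z)) - P Z (D (P (br X Y) W))) -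
      (3 / 4 : ℝ) • (P Z (D (P W (D (P X Y)))) - P W (D (P Z (D (P X Y))))) -
      (3 / 2 : ℝ) • (P X (D (P Y (D (P Z W)))) - P Y (D (P X (D (P Z W))))) := by
  have hc : cyc P D br (skewBr P D br X Y) Z W = cyc P D br Z W (skewBr P D br X Y) :=
    (cyc_rotate _ _ _).symm
  rw [hc, h.cyc_eq, h.pairing_skewBr_D, h.pairing_comm W (skewBr P D br X Y),
    h.pairing_comm Z (skewBr P D br X Y), h.pairing_comm _ (skewBr P D br X Y)]
  simp only [skewBr, map_sub, map_smul, LinearMap.sub_apply, LinearMap.smul_apply,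
    h.pairing_comm (D _), h.pairing_bracket_D]
  module

/-- The Leibniz identity of the Dorfman bracket, paired with a fourth section. -/
theorem pairing_bracket_bracket (X Y Z W : E) :
    P (br X Y) (br Z W) - P (br X Z) (br Y W) + P (br X W) (br Y Z) =
      P X (D (P (br Y Z) W)) - P Y (D (P (br X Z) W)) + P Z (D (P (br X Y) W)) -
        P W (D (P (br X Y) Z)) := by
  -- The Leibniz identity enters in `h5`, paired with `Y`. Each nested bracket in it is traded for
  -- products of two brackets and derivatives: `h1` treats the left side, `h2` and `h3` the term
  -- with `br X Z`, and `h4` the term with `br X W`.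
  have h1 := h.invariant X Y (br Z W)
  have h2 := h.invariant Y (br X Z) W
  have h3 := h.pairing_bracket_rotate Y (br X Z) W
  have h4 := h.invariant Z (br X W) Y
  have h5 := congrArg (P Y) (h.leibniz X Z W)
  rw [map_add, h.pairing_comm Y (br (br X Z) W), h.pairing_comm Y (br Z (br X W))] at h5
  rw [h.bracket_swap Y Z, map_sub, h.pairing_bracket_D, h.pairing_bracket_right X Y W,
    map_sub, map_sub] at h4
  rw [h.pairing_comm Y (br X Z), h.pairing_bracket_D, h.pairing_bracket_right X Y Z, map_sub,
    map_sub] at h3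
  rw [h.pairing_comm Y (br Z W), h.pairing_bracket_rotate Y Z W, map_add, map_sub, map_add,
    map_sub] at h1
  linear_combination (norm := module) (-1 : ℝ) • h1 + h2 - h3 + h4 - h5

/-- This is the fourth Jacobi identity on sections, with denominators cleared. -/
theorem cyc_jacobi (X Y Z W : E) :
    (2 : ℝ) • (cyc P D br (skewBr P D br X Y) Z W - cyc P D br (skewBr P D br X Z) Y W +
        cyc P D br (skewBr P D br X W) Y Z + cyc P D br (skewBr P D br Y Z) X W -
        cyc P D br (skewBr P D br Y W) X Z + cyc P D br (skewBr P D br Z W) X Y) +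
      (P W (D (cyc P D br X Y Z)) - P Z (D (cyc P D br X Y W)) + P Y (D (cyc P D br X Z W)) -
        P X (D (cyc P D br Y Z W))) = 0 := by
  have hQ := h.pairing_bracket_bracket X Y Z W
  simp only [h.cyc_skewBr, h.cyc_eq, map_add, map_sub, map_smul, h.pairing_bracket_right X Y Z,
    h.pairing_bracket_right X Y W, h.pairing_bracket_right X Z W, h.pairing_bracket_right Y Z W,
    h.pairing_bracket_rotate X Y Z, h.pairing_bracket_rotate X Y W, h.pairing_bracket_rotate X Z W,
    h.pairing_bracket_rotate Y Z W, h.pairing_comm (br Y Z) (br X W),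
    h.pairing_comm (br Y W) (br X Z), h.pairing_comm (br Z W) (br X Y)]
  -- Each of the three products of brackets occurs in two of the six cyclic sums, with coefficient
  -- 3, and the sums are doubled: 2 · 2 · 3 = 12.
  linear_combination (norm := module) (12 : ℝ) • hQ

end IsCourantDorfman

end CourantDorfman

/-! ### From the Courant algebroid axioms to `IsCourantDorfman`. -/

noncomputable section

section CourantProperties

variable {EM : Type*} [NormedAddCommGroup EM] [NormedSpace ℝ EM]
  {M : Type*} [TopologicalSpace M] [ChartedSpace EM M] [IsManifold 𝓘(ℝ, EM) ∞ M]
  {F : Type*} [NormedAddCommGroup F] [NormedSpace ℝ F] [FiniteDimensional ℝ F]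
  {V : M → Type*} [TopologicalSpace (TotalSpace F V)] [∀ x, TopologicalSpace (V x)]
  [∀ x, AddCommGroup (V x)] [∀ x, Module ℝ (V x)]
  [FiberBundle F V] [VectorBundle ℝ F V] [ContMDiffVectorBundle ∞ F V 𝓘(ℝ, EM)]
  {g : BundlePairing EM F V}

/-- A partition of unity glues a local extension of `v` to the zero section away from `x`. The
constraint on values is a single point in the fibre over `x` and void in the other fibres, hence
convex. -/
theorem exists_contMDiffSection_apply_eq [FiniteDimensional ℝ EM] [T2Space M]
    [SecondCountableTopology M] (x : M) (v : V x) :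
    ∃ X : Cₛ^∞⟮𝓘(ℝ, EM); F, V⟯, X x = v := by
  have : LocallyCompactSpace M := ChartedSpace.locallyCompactSpace EM M
  have hconv : ∀ y, Convex ℝ {w : V y | ∀ h : x = y, w = h ▸ v} := by
    rintro y w hw w' hw' a b - - hab h
    subst h
    rw [hw rfl, hw' rfl, ← add_smul, hab, one_smul]
  obtain ⟨s, hs⟩ := exists_contMDiffSection_forall_mem_convex_of_local (I := 𝓘(ℝ, EM))
    (n := ⊤) (F_fiber := F) V (fun y => {w | ∀ h : x = y, w = h ▸ v}) hconv fun x₀ => by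
      by_cases hx : x₀ = x
      · subst hx
        obtain ⟨U, hU, hs⟩ := FiberBundle.exists_contMDiffOn_extend (k := ∞) 𝓘(ℝ, EM) F v
        refine ⟨U, hU, _, hs, ?_⟩
        rintro y - rfl
        simp
      · refine ⟨{x}ᶜ, isOpen_compl_singleton.mem_nhds hx, fun _ => 0, ?_, ?_⟩
        · exact (contMDiff_zeroSection ℝ V).contMDiffOn
        · rintro y hy rfl
          exact absurd rfl hy
  exact ⟨s, hs x rfl⟩

namespace BundlePairing

theorem onSections_comm (X Y : Cₛ^∞⟮𝓘(ℝ, EM); F, V⟯) :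
    g.onSections X Y = g.onSections Y X := by
  ext x
  exact g.symm' x _ _

theorem onSections_dOp (ρ : AnchorMap EM F V) (X : Cₛ^∞⟮𝓘(ℝ, EM); F, V⟯)
    (f : C^∞⟮𝓘(ℝ, EM), M; 𝓘(ℝ, ℝ), ℝ⟯) : g.onSections X (g.dOp ρ f) = ρ.lieDeriv X f := by
  ext x
  exact (g.symm' x _ _).trans (g.gradAt_spec ρ f x _)

theorem onSections_separating [FiniteDimensional ℝ EM] [T2Space M] [SecondCountableTopology M]
    {X Y : Cₛ^∞⟮𝓘(ℝ, EM); F, V⟯} (h : ∀ Z, g.onSections X Z = g.onSections Y Z) : X = Y := by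
  ext x
  rw [← sub_eq_zero]
  refine g.nondegenerate' x _ fun v => ?_
  obtain ⟨Z, rfl⟩ := exists_contMDiffSection_apply_eq (EM := EM) (F := F) x v
  rw [map_sub, sub_apply, sub_eq_zero]
  exact congrArg (fun f : C^∞⟮𝓘(ℝ, EM), M; 𝓘(ℝ, ℝ), ℝ⟯ => f x) (h Z)

end BundlePairing

theorem AnchorMap.mdifferentiableAt_vectorField (ρ : AnchorMap EM F V)
    (X : Cₛ^∞⟮𝓘(ℝ, EM); F, V⟯) (x : M) :
    MDifferentiableAt 𝓘(ℝ, EM) 𝓘(ℝ, EM).tangent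
      (fun x ↦ (ρ.vectorField X x : TangentBundle 𝓘(ℝ, EM) M)) x :=
  (ContMDiffAt.clm_bundle_apply (F₁ := F) (F₂ := EM) (ρ.contMDiff' x)
    (X.contMDiff x)).mdifferentiableAt (by simp)

namespace CourantAlgebroid

variable (C : CourantAlgebroid g)

theorem onSections_D (X : Cₛ^∞⟮𝓘(ℝ, EM); F, V⟯) (f : C^∞⟮𝓘(ℝ, EM), M; 𝓘(ℝ, ℝ), ℝ⟯) :
    g.onSections X (C.D f) = C.anchor.lieDeriv X f :=
  g.onSections_dOp C.anchor X f

/-- Polarisation of `bracket_self`. -/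
theorem bracket_swap (X Y : Cₛ^∞⟮𝓘(ℝ, EM); F, V⟯) :
    C.bracket Y X = C.D (g.onSections X Y) - C.bracket X Y := by
  have h : C.bracket (X + Y) (X + Y) = (1 / 2 : ℝ) • C.D (g.onSections (X + Y) (X + Y)) :=
    C.bracket_self (X + Y)
  have hX : C.bracket X X = (1 / 2 : ℝ) • C.D (g.onSections X X) := C.bracket_self X
  have hY : C.bracket Y Y = (1 / 2 : ℝ) • C.D (g.onSections Y Y) := C.bracket_self Y
  simp only [map_add, LinearMap.add_apply, hX, hY, BundlePairing.onSections_comm Y X] at h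
  linear_combination (norm := module) h

theorem lieDeriv_bracket [CompleteSpace EM] (X Y : Cₛ^∞⟮𝓘(ℝ, EM); F, V⟯)
    (f : C^∞⟮𝓘(ℝ, EM), M; 𝓘(ℝ, ℝ), ℝ⟯) :
    C.anchor.lieDeriv (C.bracket X Y) f =
      C.anchor.lieDeriv X (C.anchor.lieDeriv Y f) -
        C.anchor.lieDeriv Y (C.anchor.lieDeriv X f) := by
  ext x
  have h := VectorField.mvfderiv_mlieBracket f.contMDiff
    (C.anchor.mdifferentiableAt_vectorField X x) (C.anchor.mdifferentiableAt_vectorField Y x)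
    ((C.anchor.lieDeriv X f).contMDiff.mdifferentiableAt (by simp))
    ((C.anchor.lieDeriv Y f).contMDiff.mdifferentiableAt (by simp))
  rw [← C.anchor_bracket] at h
  exact h

variable [FiniteDimensional ℝ EM] [T2Space M] [SecondCountableTopology M]

/-- Invariance applied to `X`, `D f`, `Y`, with the anchor turning brackets into commutators, gives
⟨[X, D f], Y⟩ = ρ(Y)ρ(X)f for every `Y`. Hence [X, D f] = D⟨X, D f⟩, and `bracket_swap` leaves
nothing for [D f, X]. -/
theorem bracket_D_left (f : C^∞⟮𝓘(ℝ, EM), M; 𝓘(ℝ, ℝ), ℝ⟯) (X : Cₛ^∞⟮𝓘(ℝ, EM); F, V⟯) :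
    C.bracket (C.D f) X = 0 := by
  have : CompleteSpace EM := FiniteDimensional.complete ℝ EM
  rw [C.bracket_swap X (C.D f), sub_eq_zero]
  refine g.onSections_separating fun Y => ?_
  have h := C.anchor_pairing X (C.D f) Y
  rw [g.onSections_comm (C.D f) Y, g.onSections_comm (C.D f), C.onSections_D, C.onSections_D,
    C.lieDeriv_bracket] at h
  rw [g.onSections_comm _ Y, C.onSections_D, C.onSections_D]
  linear_combination (norm := module) h

/-- Brackets with `D f` on the left vanish, so the Leibniz rule for [D f, f' D f] reduces to ⟨D f, D
f'⟩ D f = 0. Pairing this with `D f'` gives a square that is zero. -/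
theorem onSections_D_D (f f' : C^∞⟮𝓘(ℝ, EM), M; 𝓘(ℝ, ℝ), ℝ⟯) :
    g.onSections (C.D f) (C.D f') = 0 := by
  have h := C.bracket_funSmul (C.D f) (C.D f) f'
  rw [C.bracket_D_left, C.bracket_D_left] at h
  ext x
  have h' := congrArg (fun X : Cₛ^∞⟮𝓘(ℝ, EM); F, V⟯ => g.toFun x (X x) (C.D f' x)) h
  have e : C.anchor.lieDeriv (C.D f) f' x = g.toFun x (C.D f x) (C.D f' x) :=
    congrArg (fun u : C^∞⟮𝓘(ℝ, EM), M; 𝓘(ℝ, ℝ), ℝ⟯ => u x) (C.onSections_D (C.D f) f').symm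
  have h2 : g.toFun x (C.D f x) (C.D f' x) * g.toFun x (C.D f x) (C.D f' x) = 0 := by
    simpa [funSmul, e] using h'.symm
  exact mul_self_eq_zero.1 h2

/-- The algebraic identities satisfied by the operations of a Courant algebroid. -/
theorem isCourantDorfman : IsCourantDorfman g.onSections C.D C.bracket where
  pairing_comm := g.onSections_comm
  leibniz := C.left_leibniz
  bracket_swap := C.bracket_swap
  invariant X Y Z := (C.onSections_D X _).trans (C.anchor_pairing X Y Z)
  bracket_D_left := C.bracket_D_left
  pairing_D_D := C.onSections_D_D

end CourantAlgebroid

/-! ### The sum of two compatible Courant algebroids. -/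

/-- The sum of two anchors. -/
def AnchorMap.add (ρ ρ' : AnchorMap EM F V) : AnchorMap EM F V where
  toFun x := ρ.toFun x + ρ'.toFun x
  contMDiff' := ρ.contMDiff'.add_section ρ'.contMDiff'

theorem AnchorMap.vectorField_add (ρ ρ' : AnchorMap EM F V) (X : Cₛ^∞⟮𝓘(ℝ, EM); F, V⟯) :
    (ρ.add ρ').vectorField X = ρ.vectorField X + ρ'.vectorField X := rfl

theorem AnchorMap.vectorField_map_add (ρ : AnchorMap EM F V) (X Y : Cₛ^∞⟮𝓘(ℝ, EM); F, V⟯) :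
    ρ.vectorField (X + Y) = ρ.vectorField X + ρ.vectorField Y := by
  ext x
  simp [vectorField]

theorem AnchorMap.lieDeriv_add (ρ ρ' : AnchorMap EM F V) (X : Cₛ^∞⟮𝓘(ℝ, EM); F, V⟯)
    (f : C^∞⟮𝓘(ℝ, EM), M; 𝓘(ℝ, ℝ), ℝ⟯) :
    (ρ.add ρ').lieDeriv X f = ρ.lieDeriv X f + ρ'.lieDeriv X f := by
  ext x
  exact map_add (mvfderiv 𝓘(ℝ, EM) f x) _ _

theorem BundlePairing.dOp_add (ρ ρ' : AnchorMap EM F V) :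
    g.dOp (ρ.add ρ') = g.dOp ρ + g.dOp ρ' := by
  ext f x
  refine (g.eq_gradAt (ρ.add ρ') f x (g.gradAt ρ f x + g.gradAt ρ' f x) fun v => ?_).symm
  rw [map_add, add_apply, g.gradAt_spec, g.gradAt_spec]
  exact (map_add (mvfderiv 𝓘(ℝ, EM) f x) _ _).symm

namespace CourantAlgebroid

/-- The sum of two compatible Courant algebroids. -/
def add [CompleteSpace EM] (C C' : CourantAlgebroid g) (h : C.Compatible C') :
    CourantAlgebroid g where
  bracket := C.bracket + C'.bracket
  anchor := C.anchor.add C'.anchor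
  left_leibniz X Y Z := by
    simp only [LinearMap.add_apply, map_add]
    -- The cross terms of the expanded identity are exactly the compatibility condition.
    linear_combination (norm := module) C.left_leibniz X Y Z + C'.left_leibniz X Y Z +
      h.bracket X Y Z
  bracket_funSmul X Y f := by
    have hl : ∀ (f f' : C^∞⟮𝓘(ℝ, EM), M; 𝓘(ℝ, ℝ), ℝ⟯) (Z : Cₛ^∞⟮𝓘(ℝ, EM); F, V⟯),
        funSmul (f + f') Z = funSmul f Z + funSmul f' Z := fun f f' Z => by
      ext x; exact add_smul _ _ _
    have hr : ∀ (f : C^∞⟮𝓘(ℝ, EM), M; 𝓘(ℝ, ℝ), ℝ⟯) (Z Z' : Cₛ^∞⟮𝓘(ℝ, EM); F, V⟯),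
        funSmul f (Z + Z') = funSmul f Z + funSmul f Z' := fun f Z Z' => by
      ext x; exact smul_add _ _ _
    simp only [LinearMap.add_apply, AnchorMap.lieDeriv_add, hl, hr, C.bracket_funSmul,
      C'.bracket_funSmul]
    abel
  anchor_bracket X Y := by
    have : IsManifold 𝓘(ℝ, EM) 2 M := .of_le (n := ∞) (by norm_cast)
    simp only [LinearMap.add_apply, AnchorMap.vectorField_add, AnchorMap.vectorField_map_add]
    have hm := h.anchor X Y
    ext1 x
    have d : ∀ (D : CourantAlgebroid g) Z, _ := fun D Z => D.anchor.mdifferentiableAt_vectorField Z x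
    rw [VectorField.mlieBracket_add_left (d C X) (d C' X),
      VectorField.mlieBracket_add_right (d C Y) (d C' Y),
      VectorField.mlieBracket_add_right (d C Y) (d C' Y)]
    have hx := congrFun hm x
    have h1 := congrFun (C.anchor_bracket X Y) x
    have h2 := congrFun (C'.anchor_bracket X Y) x
    simp only [Pi.add_apply] at hx ⊢
    rw [← h1, ← h2]
    linear_combination (norm := module) hx
  bracket_self X := by
    rw [BundlePairing.dOp_add]
    simp only [LinearMap.add_apply, C.bracket_self, C'.bracket_self, smul_add]
  anchor_pairing X Y Z := by
    simp only [LinearMap.add_apply, AnchorMap.lieDeriv_add, C.anchor_pairing, C'.anchor_pairing,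
      map_add]
    abel

theorem D_add [CompleteSpace EM] (C C' : CourantAlgebroid g) (h : C.Compatible C') :
    (C.add C' h).D = C.D + C'.D :=
  g.dOp_add C.anchor C'.anchor

theorem skewBracket_add [CompleteSpace EM] (C C' : CourantAlgebroid g) (h : C.Compatible C') :
    (C.add C' h).skewBracket = C.skewBracket + C'.skewBracket := by
  ext1 X
  ext1 Y
  simp only [skewBracket, D_add, LinearMap.add_apply, LinearMap.sub_apply, LinearMap.smul_apply,
    LinearMap.compr₂_apply, smul_add]
  rw [add]
  simp only [LinearMap.add_apply]
  abel

/-- In each structure map every term contains one factor `D` or one bracket, and the pairing is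
common to both algebroids. -/
theorem structureMaps_add [CompleteSpace EM] (C C' : CourantAlgebroid g) (h : C.Compatible C')
    (k : ℕ) : (C.add C' h).structureMaps k = C.structureMaps k + C'.structureMaps k := by
  ext1 u
  match k with
  | 0 => exact (add_zero _).symm
  | 1 =>
    refine Prod.ext (add_zero _).symm ?_
    exact congrArg (· (u 0).1) (C.D_add C' h)
  | 2 =>
    refine Prod.ext ?_ ?_
    · simp only [structureMaps, l₂, add_apply, MultilinearMap.coe_mk, D_add,
        LinearMap.add_apply, map_add, Prod.fst_add]
      module
    · exact congrArg (· (u 0).2 (u 1).2) (C.skewBracket_add C' h)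
  | 3 =>
    refine Prod.ext ?_ (add_zero _).symm
    simp only [structureMaps, l₃, add_apply, MultilinearMap.coe_mk, skewBracket_add,
      LinearMap.add_apply, map_add, Prod.fst_add]
    module
  | _ + 4 => exact (add_zero _).symm

end CourantAlgebroid

end CourantProperties

end

/-! ### Enumeration of shuffles and Koszul signs. -/

section Shuffles

/-- This applies when at most one argument is a function. With more functions, the third and fourth
Jacobi identities hold term by term and signs do not matter. -/
theorem koszulChi_eq_sign {n : ℕ} {d : Fin n → ℤ} (hd : ∀ i j, i ≠ j → d i * d j = 0)
    (σ : Equiv.Perm (Fin n)) : koszulChi d σ = Equiv.Perm.sign σ := by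
  rw [koszulChi, Finset.prod_eq_one fun p _ => Finset.prod_eq_one fun q _ => ?_, mul_one]
  split_ifs with h
  · rw [hd _ _ (σ.injective.ne h.1.ne), Int.negOnePow_zero]
  · rfl

/-- The permutation of `Fin n` with the given lists of values and of values of the inverse. -/
abbrev permOf {n : ℕ} (v w : Fin n → Fin n) (h : ∀ i, w (v i) = i) (h' : ∀ i, v (w i) = i) :
    Equiv.Perm (Fin n) := ⟨v, w, h, h'⟩

theorem sum_shuffle_self {A : Type*} [AddCommMonoid A] (n : ℕ) (f : Equiv.Perm (Fin n) → A) :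
    ∑ σ : Equiv.Perm (Fin n) with IsShuffle n σ, f σ = f 1 := by
  have : Finset.univ.filter (IsShuffle (n := n) n) = {1} := by
    ext σ
    simp only [Finset.mem_filter, Finset.mem_univ, true_and, Finset.mem_singleton]
    constructor
    · intro h
      have hm : StrictMono σ := fun p q hpq => h.1 p q hpq q.2
      exact Equiv.ext fun i => congrFun ((hm.range_inj strictMono_id).1
        (by rw [σ.surjective.range_eq, Set.range_id])) i
    · rintro rfl
      exact ⟨fun p q h _ => h, fun p q h _ => h⟩
  rw [this, Finset.sum_singleton]

variable {A : Type*} [AddCommMonoid A]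

theorem sum_shuffle_one_two (f : Equiv.Perm (Fin 2) → A) :
    ∑ σ : Equiv.Perm (Fin 2) with IsShuffle 1 σ, f σ =
      f 1 + f (permOf ![1, 0] ![1, 0] (by decide) (by decide)) := by
  have : Finset.univ.filter (IsShuffle (n := 2) 1) =
      {1, permOf ![1, 0] ![1, 0] (by decide) (by decide)} := by decide
  rw [this, Finset.sum_pair (by decide)]

theorem sum_shuffle_one_three (f : Equiv.Perm (Fin 3) → A) :
    ∑ σ : Equiv.Perm (Fin 3) with IsShuffle 1 σ, f σ =
      f 1 + (f (permOf ![1, 0, 2] ![1, 0, 2] (by decide) (by decide)) +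
        f (permOf ![2, 0, 1] ![1, 2, 0] (by decide) (by decide))) := by
  have : Finset.univ.filter (IsShuffle (n := 3) 1) =
      {1, permOf ![1, 0, 2] ![1, 0, 2] (by decide) (by decide),
        permOf ![2, 0, 1] ![1, 2, 0] (by decide) (by decide)} := by decide
  rw [this, Finset.sum_insert (by decide), Finset.sum_pair (by decide)]

theorem sum_shuffle_two_three (f : Equiv.Perm (Fin 3) → A) :
    ∑ σ : Equiv.Perm (Fin 3) with IsShuffle 2 σ, f σ =
      f 1 + (f (permOf ![0, 2, 1] ![0, 2, 1] (by decide) (by decide)) +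
        f (permOf ![1, 2, 0] ![2, 0, 1] (by decide) (by decide))) := by
  have : Finset.univ.filter (IsShuffle (n := 3) 2) =
      {1, permOf ![0, 2, 1] ![0, 2, 1] (by decide) (by decide),
        permOf ![1, 2, 0] ![2, 0, 1] (by decide) (by decide)} := by decide
  rw [this, Finset.sum_insert (by decide), Finset.sum_pair (by decide)]

set_option maxRecDepth 10000 in
theorem sum_shuffle_two_four (f : Equiv.Perm (Fin 4) → A) :
    ∑ σ : Equiv.Perm (Fin 4) with IsShuffle 2 σ, f σ =
      f 1 + (f (permOf ![0, 2, 1, 3] ![0, 2, 1, 3] (by decide) (by decide)) +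
        (f (permOf ![0, 3, 1, 2] ![0, 2, 3, 1] (by decide) (by decide)) +
        (f (permOf ![1, 2, 0, 3] ![2, 0, 1, 3] (by decide) (by decide)) +
        (f (permOf ![1, 3, 0, 2] ![2, 0, 3, 1] (by decide) (by decide)) +
        f (permOf ![2, 3, 0, 1] ![2, 3, 0, 1] (by decide) (by decide)))))) := by
  have : Finset.univ.filter (IsShuffle (n := 4) 2) =
      {1, permOf ![0, 2, 1, 3] ![0, 2, 1, 3] (by decide) (by decide),
        permOf ![0, 3, 1, 2] ![0, 2, 3, 1] (by decide) (by decide),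
        permOf ![1, 2, 0, 3] ![2, 0, 1, 3] (by decide) (by decide),
        permOf ![1, 3, 0, 2] ![2, 0, 3, 1] (by decide) (by decide),
        permOf ![2, 3, 0, 1] ![2, 3, 0, 1] (by decide) (by decide)} := by decide +kernel
  rw [this, Finset.sum_insert (by decide), Finset.sum_insert (by decide),
    Finset.sum_insert (by decide), Finset.sum_insert (by decide), Finset.sum_pair (by decide)]

set_option maxRecDepth 10000 in
theorem sum_shuffle_three_four (f : Equiv.Perm (Fin 4) → A) :
    ∑ σ : Equiv.Perm (Fin 4) with IsShuffle 3 σ, f σ =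
      f 1 + (f (permOf ![0, 1, 3, 2] ![0, 1, 3, 2] (by decide) (by decide)) +
        (f (permOf ![0, 2, 3, 1] ![0, 3, 1, 2] (by decide) (by decide)) +
        f (permOf ![1, 2, 3, 0] ![3, 0, 1, 2] (by decide) (by decide)))) := by
  have : Finset.univ.filter (IsShuffle (n := 4) 3) =
      {1, permOf ![0, 1, 3, 2] ![0, 1, 3, 2] (by decide) (by decide),
        permOf ![0, 2, 3, 1] ![0, 3, 1, 2] (by decide) (by decide),
        permOf ![1, 2, 3, 0] ![3, 0, 1, 2] (by decide) (by decide)} := by decide +kernel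
  rw [this, Finset.sum_insert (by decide), Finset.sum_insert (by decide),
    Finset.sum_pair (by decide)]

end Shuffles

/-! ### The jacobiators of up to four arguments, unfolded. -/

noncomputable section

section CourantLInfinity

variable {EM : Type*} [NormedAddCommGroup EM] [NormedSpace ℝ EM]
  {M : Type*} [TopologicalSpace M] [ChartedSpace EM M] [IsManifold 𝓘(ℝ, EM) ∞ M]
  {F : Type*} [NormedAddCommGroup F] [NormedSpace ℝ F] [FiniteDimensional ℝ F]
  {V : M → Type*} [TopologicalSpace (TotalSpace F V)] [∀ x, TopologicalSpace (V x)]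
  [∀ x, AddCommGroup (V x)] [∀ x, Module ℝ (V x)]
  [FiberBundle F V] [VectorBundle ℝ F V] [ContMDiffVectorBundle ∞ F V 𝓘(ℝ, EM)]
  {g : BundlePairing EM F V}

namespace CourantAlgebroid

variable (C : CourantAlgebroid g)

/-- The unary structure map as a function. -/
def L1 (u : LSpace EM F V) : LSpace EM F V := (0, C.D u.1)

/-- The binary structure map as a function of two arguments. -/
def L2 (u v : LSpace EM F V) : LSpace EM F V :=
  ((1 / 2 : ℝ) • g.onSections u.2 (C.D v.1) - (1 / 2 : ℝ) • g.onSections v.2 (C.D u.1),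
    IsCourantDorfman.skewBr g.onSections C.D C.bracket u.2 v.2)

/-- The ternary structure map as a function of three arguments. -/
def L3 (u v w : LSpace EM F V) : LSpace EM F V :=
  (-(1 / 6 : ℝ) • IsCourantDorfman.cyc g.onSections C.D C.bracket u.2 v.2 w.2, 0)

theorem jacobiator_one (d : Fin 1 → ℤ) (x : Fin 1 → LSpace EM F V) :
    jacobiator C.structureMaps C.structureMaps d x =
      ∑ σ : Equiv.Perm (Fin 1) with IsShuffle 1 σ,
        (koszulChi d σ * (-1) ^ (1 * 0)) • C.L1 (C.L1 (x (σ 0))) :=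
  Fin.sum_univ_one _

theorem jacobiator_two (d : Fin 2 → ℤ) (x : Fin 2 → LSpace EM F V) :
    jacobiator C.structureMaps C.structureMaps d x =
      ∑ σ : Equiv.Perm (Fin 2) with IsShuffle 1 σ,
        (koszulChi d σ * (-1) ^ (1 * 1)) • C.L2 (C.L1 (x (σ 0))) (x (σ 1)) +
      ∑ σ : Equiv.Perm (Fin 2) with IsShuffle 2 σ,
        (koszulChi d σ * (-1) ^ (2 * 0)) • C.L1 (C.L2 (x (σ 0)) (x (σ 1))) :=
  Fin.sum_univ_two _

theorem jacobiator_three (d : Fin 3 → ℤ) (x : Fin 3 → LSpace EM F V) :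
    jacobiator C.structureMaps C.structureMaps d x =
      ∑ σ : Equiv.Perm (Fin 3) with IsShuffle 1 σ,
        (koszulChi d σ * (-1) ^ (1 * 2)) • C.L3 (C.L1 (x (σ 0))) (x (σ 1)) (x (σ 2)) +
      ∑ σ : Equiv.Perm (Fin 3) with IsShuffle 2 σ,
        (koszulChi d σ * (-1) ^ (2 * 1)) • C.L2 (C.L2 (x (σ 0)) (x (σ 1))) (x (σ 2)) +
      ∑ σ : Equiv.Perm (Fin 3) with IsShuffle 3 σ,
        (koszulChi d σ * (-1) ^ (3 * 0)) • C.L1 (C.L3 (x (σ 0)) (x (σ 1)) (x (σ 2))) :=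
  Fin.sum_univ_three _

theorem jacobiator_four (d : Fin 4 → ℤ) (x : Fin 4 → LSpace EM F V) :
    jacobiator C.structureMaps C.structureMaps d x =
      ∑ σ : Equiv.Perm (Fin 4) with IsShuffle 1 σ,
        -- The outer map has arity 4 and is zero.
        (koszulChi d σ * (-1) ^ (1 * 3)) • (0 : LSpace EM F V) +
      ∑ σ : Equiv.Perm (Fin 4) with IsShuffle 2 σ,
        (koszulChi d σ * (-1) ^ (2 * 2)) • C.L3 (C.L2 (x (σ 0)) (x (σ 1))) (x (σ 2)) (x (σ 3)) +
      ∑ σ : Equiv.Perm (Fin 4) with IsShuffle 3 σ,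
        (koszulChi d σ * (-1) ^ (3 * 1)) • C.L2 (C.L3 (x (σ 0)) (x (σ 1)) (x (σ 2))) (x (σ 3)) +
      ∑ σ : Equiv.Perm (Fin 4) with IsShuffle 4 σ,
        (koszulChi d σ * (-1) ^ (4 * 0)) • C.L1 0 :=
  Fin.sum_univ_four _

end CourantAlgebroid

end CourantLInfinity

end

/-! ### Grading, degrees and skew-symmetry. -/

noncomputable section

section CourantLInfinityAlgebra

variable {EM : Type*} [NormedAddCommGroup EM] [NormedSpace ℝ EM]
  {M : Type*} [TopologicalSpace M] [ChartedSpace EM M] [IsManifold 𝓘(ℝ, EM) ∞ M]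
  {F : Type*} [NormedAddCommGroup F] [NormedSpace ℝ F] [FiniteDimensional ℝ F]
  {V : M → Type*} [TopologicalSpace (TotalSpace F V)] [∀ x, TopologicalSpace (V x)]
  [∀ x, AddCommGroup (V x)] [∀ x, Module ℝ (V x)]
  [FiberBundle F V] [VectorBundle ℝ F V] [ContMDiffVectorBundle ∞ F V 𝓘(ℝ, EM)]
  {g : BundlePairing EM F V}

namespace CourantAlgebroid

theorem mem_grading_neg_one {u : LSpace EM F V} : u ∈ grading EM F V (-1) ↔ u.2 = 0 := by
  rw [grading, if_pos rfl, LinearMap.range_inl, LinearMap.mem_ker, LinearMap.snd_apply]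

theorem mem_grading_zero {u : LSpace EM F V} : u ∈ grading EM F V 0 ↔ u.1 = 0 := by
  rw [grading, if_neg (by decide), if_pos rfl, LinearMap.range_inr, LinearMap.mem_ker,
    LinearMap.fst_apply]

/-- The case `u = 0` stands apart because zero is homogeneous of every degree and then says nothing
about `i`. -/
theorem eq_zero_or_of_mem_grading {i : ℤ} {u : LSpace EM F V} (hu : u ∈ grading EM F V i) :
    u = 0 ∨ (i = -1 ∧ u.2 = 0) ∨ (i = 0 ∧ u.1 = 0) := by
  by_cases h1 : i = -1
  · subst h1; exact .inr (.inl ⟨rfl, mem_grading_neg_one.1 hu⟩)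
  by_cases h0 : i = 0
  · subst h0; exact .inr (.inr ⟨rfl, mem_grading_zero.1 hu⟩)
  · rw [grading, if_neg h1, if_neg h0] at hu
    exact .inl ((Submodule.mem_bot ℝ).1 hu)

theorem snd_eq_zero_or_of_mem_grading {i : ℤ} {u : LSpace EM F V} (hu : u ∈ grading EM F V i) :
    u.2 = 0 ∨ (i = 0 ∧ u.1 = 0) := by
  rcases eq_zero_or_of_mem_grading hu with rfl | h | h
  · exact .inl rfl
  · exact .inl h.2
  · exact .inr h

theorem fst_eq_zero_or_of_mem_grading {i : ℤ} {u : LSpace EM F V} (hu : u ∈ grading EM F V i) :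
    u.1 = 0 ∨ (i = -1 ∧ u.2 = 0) := by
  rcases eq_zero_or_of_mem_grading hu with rfl | h | h
  · exact .inl rfl
  · exact .inr h
  · exact .inl h.2

theorem isInternal_grading : DirectSum.IsInternal (grading EM F V) := by
  refine DirectSum.isInternal_submodule_of_iSupIndep_of_iSup_eq_top ?_ ?_
  · rw [iSupIndep_def]
    intro i
    rw [Submodule.disjoint_def]
    intro u hu hu'
    by_cases h1 : i = -1
    · subst h1
      have hle : ⨆ j, ⨆ (_ : j ≠ -1), grading EM F V j ≤ grading EM F V 0 :=
        iSup₂_le fun j hj w hw => by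
          rcases eq_zero_or_of_mem_grading hw with rfl | h | h
          · exact Submodule.zero_mem _
          · exact absurd h.1 hj
          · exact mem_grading_zero.2 h.2
      exact Prod.ext (mem_grading_zero.1 (hle hu')) (mem_grading_neg_one.1 hu)
    by_cases h0 : i = 0
    · subst h0
      have hle : ⨆ j, ⨆ (_ : j ≠ 0), grading EM F V j ≤ grading EM F V (-1) :=
        iSup₂_le fun j hj w hw => by
          rcases eq_zero_or_of_mem_grading hw with rfl | h | h
          · exact Submodule.zero_mem _
          · exact mem_grading_neg_one.2 h.2
          · exact absurd h.1 hj
      exact Prod.ext (mem_grading_zero.1 hu) (mem_grading_neg_one.1 (hle hu'))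
    · rcases eq_zero_or_of_mem_grading hu with h | h | h
      · exact h
      · exact absurd h.1 h1
      · exact absurd h.1 h0
  · rw [eq_top_iff]
    rintro u -
    have hu : u = (u.1, 0) + (0, u.2) := by simp
    rw [hu]
    exact add_mem
      (Submodule.mem_iSup_of_mem (-1) (mem_grading_neg_one.2 rfl))
      (Submodule.mem_iSup_of_mem 0 (mem_grading_zero.2 rfl))

variable {C : CourantAlgebroid g}

theorem structureMaps_eq_zero {k : ℕ} (hk : 4 ≤ k) : C.structureMaps k = 0 := by
  obtain ⟨k, rfl⟩ := Nat.exists_eq_add_of_le' hk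
  rfl

theorem L3_eq_zero {u v w : LSpace EM F V} (h : u.2 = 0 ∨ v.2 = 0 ∨ w.2 = 0) :
    C.L3 u v w = 0 := by
  rcases h with h | h | h <;> simp [L3, h, IsCourantDorfman.cyc, IsCourantDorfman.skewBr]

theorem zero_zero_mem_grading (i : ℤ) :
    ((0, 0) : LSpace EM F V) ∈ grading EM F V i :=
  Submodule.zero_mem _

theorem structureMaps_mem_grading (k : ℕ) (hk : 1 ≤ k) (d : Fin k → ℤ)
    (x : Fin k → LSpace EM F V) (hx : ∀ i, x i ∈ grading EM F V (d i)) :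
    C.structureMaps k x ∈ grading EM F V (∑ i, d i + (2 - k)) := by
  match k, hk with
  | 1, _ =>
    change C.L1 (x 0) ∈ _
    rcases fst_eq_zero_or_of_mem_grading (hx 0) with h | h
    · simp [L1, h, zero_zero_mem_grading]
    · simp [h.1, mem_grading_zero, L1]
  | 2, _ =>
    change C.L2 (x 0) (x 1) ∈ _
    -- For two functions the target degree is -2, where only zero lives, and `L2` indeed vanishes.
    rcases eq_zero_or_of_mem_grading (hx 0) with h | h | h <;>
    rcases eq_zero_or_of_mem_grading (hx 1) with h' | h' | h' <;>
    simp [h, h', L2, IsCourantDorfman.skewBr, mem_grading_neg_one, mem_grading_zero,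
      zero_zero_mem_grading]
  | 3, _ =>
    change C.L3 (x 0) (x 1) (x 2) ∈ _
    rcases snd_eq_zero_or_of_mem_grading (hx 0) with h | h
    · simp [L3_eq_zero, h]
    rcases snd_eq_zero_or_of_mem_grading (hx 1) with h' | h'
    · simp [L3_eq_zero, h']
    rcases snd_eq_zero_or_of_mem_grading (hx 2) with h'' | h''
    · simp [L3_eq_zero, h'']
    simp [Fin.sum_univ_three, h.1, h'.1, h''.1, mem_grading_neg_one, L3]
  | k + 4, _ =>
    rw [structureMaps_eq_zero (by omega)]
    exact Submodule.zero_mem _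

theorem perm_fin_two (σ : Equiv.Perm (Fin 2)) :
    σ = 1 ∨ σ = permOf ![1, 0] ![1, 0] (by decide) (by decide) := by
  revert σ; decide

theorem perm_fin_three (σ : Equiv.Perm (Fin 3)) :
    (σ 0 = 0 ∧ σ 1 = 1 ∧ σ 2 = 2 ∧ Equiv.Perm.sign σ = 1) ∨
    (σ 0 = 0 ∧ σ 1 = 2 ∧ σ 2 = 1 ∧ Equiv.Perm.sign σ = -1) ∨
    (σ 0 = 1 ∧ σ 1 = 0 ∧ σ 2 = 2 ∧ Equiv.Perm.sign σ = -1) ∨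
    (σ 0 = 1 ∧ σ 1 = 2 ∧ σ 2 = 0 ∧ Equiv.Perm.sign σ = 1) ∨
    (σ 0 = 2 ∧ σ 1 = 0 ∧ σ 2 = 1 ∧ Equiv.Perm.sign σ = 1) ∨
    (σ 0 = 2 ∧ σ 1 = 1 ∧ σ 2 = 0 ∧ Equiv.Perm.sign σ = -1) := by
  revert σ; decide

theorem koszulChi_one {n : ℕ} (d : Fin n → ℤ) : koszulChi d 1 = 1 := by
  rw [koszulChi, Finset.prod_eq_one fun p _ => Finset.prod_eq_one fun q _ => ?_, mul_one]
  · exact Equiv.Perm.sign_one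
  · exact if_neg fun h => h.1.not_gt h.2

theorem koszulChi_swap (d : Fin 2 → ℤ) :
    koszulChi d (permOf ![1, 0] ![1, 0] (by decide) (by decide)) =
      -(d 1 * d 0).negOnePow := by
  have hs : Equiv.Perm.sign (permOf ![1, 0] ![1, 0] (by decide) (by decide) :
      Equiv.Perm (Fin 2)) = -1 := by decide
  rw [koszulChi, hs]
  simp [Fin.prod_univ_two]

variable (h : IsCourantDorfman g.onSections C.D C.bracket)
include h

theorem L3_swap_left (u v w : LSpace EM F V) : C.L3 v u w = -C.L3 u v w := by
  refine Prod.ext ?_ neg_zero.symm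
  simp [L3, h.cyc_swap u.2 v.2]

omit h in
theorem L3_rotate (u v w : LSpace EM F V) : C.L3 v w u = C.L3 u v w := by
  rw [L3, IsCourantDorfman.cyc_rotate, L3]

theorem structureMaps_skew (k : ℕ) (hk : 1 ≤ k) (d : Fin k → ℤ)
    (x : Fin k → LSpace EM F V) (hx : ∀ i, x i ∈ grading EM F V (d i))
    (σ : Equiv.Perm (Fin k)) :
    C.structureMaps k (fun i => x (σ i)) = koszulChi d σ • C.structureMaps k x := by
  match k, hk with
  | 1, _ =>
    rw [Subsingleton.elim σ 1, koszulChi_one, one_smul]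
    rfl
  | 2, _ =>
    rcases perm_fin_two σ with rfl | rfl
    · rw [koszulChi_one, one_smul]
      rfl
    rw [koszulChi_swap]
    change C.L2 (x 1) (x 0) = _ • C.L2 (x 0) (x 1)
    have hb := h.skewBr_swap (x 0).2 (x 1).2
    rcases eq_zero_or_of_mem_grading (hx 0) with h0 | h0 | h0 <;>
    rcases eq_zero_or_of_mem_grading (hx 1) with h1 | h1 | h1 <;>
    simp [h0, h1, L2, hb] <;> simp [IsCourantDorfman.skewBr]
  | 3, _ =>
    change C.L3 (x (σ 0)) (x (σ 1)) (x (σ 2)) = _ • C.L3 (x 0) (x 1) (x 2)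
    -- If some section component is zero, both sides vanish whatever the sign. Otherwise all degrees
    -- are 0 and the sign is that of `σ`.
    by_cases hz : ∃ i, (x i).2 = 0
    · obtain ⟨i, hi⟩ := hz
      rw [L3_eq_zero, L3_eq_zero, smul_zero]
      · fin_cases i
        exacts [.inl hi, .inr (.inl hi), .inr (.inr hi)]
      · rw [← σ.apply_symm_apply i] at hi
        generalize σ.symm i = j at hi
        fin_cases j
        exacts [.inl hi, .inr (.inl hi), .inr (.inr hi)]
    push Not at hz
    have hd : ∀ i, d i = 0 := fun i => ((snd_eq_zero_or_of_mem_grading (hx i)).resolve_left (hz i)).1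
    rw [koszulChi_eq_sign fun i j _ => by rw [hd i, zero_mul]]
    rcases perm_fin_three σ with e | e | e | e | e | e <;> obtain ⟨e0, e1, e2, es⟩ := e <;>
    rw [e0, e1, e2, es] <;> simp only [one_smul, Units.neg_smul]
    · rw [L3_rotate, L3_rotate, L3_swap_left h, L3_rotate]
    · rw [L3_swap_left h]
    · rw [L3_rotate]
    · rw [← L3_rotate]
    · rw [L3_swap_left h, L3_rotate, L3_rotate]
  | k + 4, _ =>
    rw [structureMaps_eq_zero (by omega), zero_apply, zero_apply,
      smul_zero]

end CourantAlgebroid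

end CourantLInfinityAlgebra

end

/-! ### Alternating sums over shuffles. -/

section SignedShuffles

variable {A : Type*} [AddCommGroup A]

theorem sum_sign_shuffle_one_three (f : Fin 3 → Fin 3 → Fin 3 → A) :
    ∑ σ : Equiv.Perm (Fin 3) with IsShuffle 1 σ, Equiv.Perm.sign σ • f (σ 0) (σ 1) (σ 2) =
      f 0 1 2 - f 1 0 2 + f 2 0 1 := by
  rw [sum_shuffle_one_three]
  have e1 : Equiv.Perm.sign (permOf ![1, 0, 2] ![1, 0, 2] (by decide) (by decide) :
    Equiv.Perm (Fin 3)) = -1 := by decide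
  have e2 : Equiv.Perm.sign (permOf ![2, 0, 1] ![1, 2, 0] (by decide) (by decide) :
    Equiv.Perm (Fin 3)) = 1 := by decide
  rw [e1, e2, Equiv.Perm.sign_one, one_smul, one_smul, Units.neg_smul, one_smul, sub_eq_add_neg,
    add_assoc]
  rfl

theorem sum_sign_shuffle_two_three (f : Fin 3 → Fin 3 → Fin 3 → A) :
    ∑ σ : Equiv.Perm (Fin 3) with IsShuffle 2 σ, Equiv.Perm.sign σ • f (σ 0) (σ 1) (σ 2) =
      f 0 1 2 - f 0 2 1 + f 1 2 0 := by
  rw [sum_shuffle_two_three]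
  have e1 : Equiv.Perm.sign (permOf ![0, 2, 1] ![0, 2, 1] (by decide) (by decide) :
    Equiv.Perm (Fin 3)) = -1 := by decide
  have e2 : Equiv.Perm.sign (permOf ![1, 2, 0] ![2, 0, 1] (by decide) (by decide) :
    Equiv.Perm (Fin 3)) = 1 := by decide
  rw [e1, e2, Equiv.Perm.sign_one, one_smul, one_smul, Units.neg_smul, one_smul, sub_eq_add_neg,
    add_assoc]
  rfl

theorem sum_sign_shuffle_two_four (f : Fin 4 → Fin 4 → Fin 4 → Fin 4 → A) :
    ∑ σ : Equiv.Perm (Fin 4) with IsShuffle 2 σ,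
        Equiv.Perm.sign σ • f (σ 0) (σ 1) (σ 2) (σ 3) =
      f 0 1 2 3 - f 0 2 1 3 + f 0 3 1 2 + f 1 2 0 3 - f 1 3 0 2 + f 2 3 0 1 := by
  rw [sum_shuffle_two_four]
  have e1 : Equiv.Perm.sign (permOf ![0, 2, 1, 3] ![0, 2, 1, 3] (by decide) (by decide) :
    Equiv.Perm (Fin 4)) = -1 := by decide
  have e2 : Equiv.Perm.sign (permOf ![0, 3, 1, 2] ![0, 2, 3, 1] (by decide) (by decide) :
    Equiv.Perm (Fin 4)) = 1 := by decide
  have e3 : Equiv.Perm.sign (permOf ![1, 2, 0, 3] ![2, 0, 1, 3] (by decide) (by decide) :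
    Equiv.Perm (Fin 4)) = 1 := by decide
  have e4 : Equiv.Perm.sign (permOf ![1, 3, 0, 2] ![2, 0, 3, 1] (by decide) (by decide) :
    Equiv.Perm (Fin 4)) = -1 := by decide
  have e5 : Equiv.Perm.sign (permOf ![2, 3, 0, 1] ![2, 3, 0, 1] (by decide) (by decide) :
    Equiv.Perm (Fin 4)) = 1 := by decide
  rw [e1, e2, e3, e4, e5]
  simp only [Equiv.Perm.sign_one, one_smul, Units.neg_smul, sub_eq_add_neg, add_assoc]
  rfl

theorem sum_sign_shuffle_three_four (f : Fin 4 → Fin 4 → Fin 4 → Fin 4 → A) :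
    ∑ σ : Equiv.Perm (Fin 4) with IsShuffle 3 σ,
        Equiv.Perm.sign σ • f (σ 0) (σ 1) (σ 2) (σ 3) =
      f 0 1 2 3 - f 0 1 3 2 + f 0 2 3 1 - f 1 2 3 0 := by
  rw [sum_shuffle_three_four]
  have e1 : Equiv.Perm.sign (permOf ![0, 1, 3, 2] ![0, 1, 3, 2] (by decide) (by decide) :
    Equiv.Perm (Fin 4)) = -1 := by decide
  have e2 : Equiv.Perm.sign (permOf ![0, 2, 3, 1] ![0, 3, 1, 2] (by decide) (by decide) :
    Equiv.Perm (Fin 4)) = 1 := by decide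
  have e3 : Equiv.Perm.sign (permOf ![1, 2, 3, 0] ![3, 0, 1, 2] (by decide) (by decide) :
    Equiv.Perm (Fin 4)) = -1 := by decide
  rw [e1, e2, e3]
  simp only [Equiv.Perm.sign_one, one_smul, Units.neg_smul, sub_eq_add_neg, add_assoc]
  rfl

end SignedShuffles

/-! ### The higher Jacobi identities. -/

noncomputable section

section CourantJacobi

variable {EM : Type*} [NormedAddCommGroup EM] [NormedSpace ℝ EM]
  {M : Type*} [TopologicalSpace M] [ChartedSpace EM M] [IsManifold 𝓘(ℝ, EM) ∞ M]
  {F : Type*} [NormedAddCommGroup F] [NormedSpace ℝ F] [FiniteDimensional ℝ F]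
  {V : M → Type*} [TopologicalSpace (TotalSpace F V)] [∀ x, TopologicalSpace (V x)]
  [∀ x, AddCommGroup (V x)] [∀ x, Module ℝ (V x)]
  [FiberBundle F V] [VectorBundle ℝ F V] [ContMDiffVectorBundle ∞ F V 𝓘(ℝ, EM)]
  {g : BundlePairing EM F V}

namespace CourantAlgebroid

variable {C : CourantAlgebroid g}

theorem jacobiator_eq_zero_of_five_le {n : ℕ} (hn : 5 ≤ n) (d : Fin n → ℤ)
    (x : Fin n → LSpace EM F V) : jacobiator C.structureMaps C.structureMaps d x = 0 := by
  refine Finset.sum_eq_zero fun a _ => Finset.sum_eq_zero fun σ _ => ?_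
  by_cases h1 : 4 ≤ (a : ℕ) + 1
  · rw [structureMaps_eq_zero h1, MultilinearMap.map_coord_zero _ 0, smul_zero]
    rfl
  by_cases h2 : 4 ≤ n - 1 - a + 1
  · rw [structureMaps_eq_zero h2, zero_apply, smul_zero]
  -- The arities add up to n + 1 ≥ 6 and neither exceeds 3, so both are 3. The inner `L3` is then a
  -- function, which the outer `L3` kills.
  obtain rfl : n = 5 := by omega
  obtain rfl : a = 2 := Fin.ext (by simp; omega)
  refine (congrArg _ ?_).trans (smul_zero _)
  exact L3_eq_zero (u := C.L3 (x (σ 0)) (x (σ 1)) (x (σ 2))) (v := x (σ 3)) (w := x (σ 4))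
    (.inl rfl)

variable (h : IsCourantDorfman g.onSections C.D C.bracket)
include h

omit h in
theorem jacobi_one (d : Fin 1 → ℤ) (x : Fin 1 → LSpace EM F V) :
    jacobiator C.structureMaps C.structureMaps d x = 0 := by
  rw [jacobiator_one]
  refine Finset.sum_eq_zero fun σ _ => (congrArg _ ?_).trans (smul_zero _)
  simp [L1]

theorem jacobi_two (d : Fin 2 → ℤ) (x : Fin 2 → LSpace EM F V)
    (hx : ∀ i, x i ∈ grading EM F V (d i)) :
    jacobiator C.structureMaps C.structureMaps d x = 0 := by
  rw [jacobiator_two, sum_shuffle_one_two, sum_shuffle_self, koszulChi_one, koszulChi_swap]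
  change (1 * (-1) ^ (1 * 1)) • C.L2 (C.L1 (x 0)) (x 1) +
    ((-(d 1 * d 0).negOnePow) * (-1) ^ (1 * 1)) • C.L2 (C.L1 (x 1)) (x 0) +
    (1 * (-1) ^ (2 * 0)) • C.L1 (C.L2 (x 0) (x 1)) = 0
  -- Two functions reduce to ⟨D f, D f'⟩ = 0. A function and a section reduce to ⌊D f, X⌋ = -½ D⟨X,
  -- D f⟩, a consequence of [D f, X] = 0.
  rcases eq_zero_or_of_mem_grading (hx 0) with h0 | h0 | h0 <;>
  rcases eq_zero_or_of_mem_grading (hx 1) with h1 | h1 | h1 <;>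
  simp [h0, h1, L1, L2, IsCourantDorfman.skewBr, h.bracket_D_left, h.pairing_D_D,
    h.pairing_comm (C.D _)]

set_option maxHeartbeats 400000 in
theorem jacobi_three (d : Fin 3 → ℤ) (x : Fin 3 → LSpace EM F V)
    (hx : ∀ i, x i ∈ grading EM F V (d i)) :
    jacobiator C.structureMaps C.structureMaps d x = 0 := by
  rw [jacobiator_three]
  -- When two arguments have no section component, every summand is zero by itself. Otherwise at
  -- most one degree is nonzero and all Koszul signs are trivial.
  by_cases hz : ∃ i j, i ≠ j ∧ (x i).2 = 0 ∧ (x j).2 = 0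
  · have key : ∀ σ : Equiv.Perm (Fin 3),
        ((x (σ 0)).2 = 0 ∧ (x (σ 1)).2 = 0) ∨ ((x (σ 0)).2 = 0 ∧ (x (σ 2)).2 = 0) ∨
          ((x (σ 1)).2 = 0 ∧ (x (σ 2)).2 = 0) := by
      intro σ
      obtain ⟨i, j, hij, hi, hj⟩ := hz
      rw [← σ.apply_symm_apply i] at hi
      rw [← σ.apply_symm_apply j] at hj
      have hij' := σ.symm.injective.ne hij
      generalize σ.symm i = i' at hi hij'
      generalize σ.symm j = j' at hj hij'
      fin_cases i' <;> fin_cases j' <;> simp_all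
    rw [Finset.sum_eq_zero, Finset.sum_eq_zero, Finset.sum_eq_zero, add_zero, add_zero]
    all_goals
      intro σ _
      refine (congrArg _ ?_).trans (smul_zero _)
      rcases key σ with e | e | e <;>
      simp [L1, L2, L3, e, IsCourantDorfman.skewBr, IsCourantDorfman.cyc]
  · have hd : ∀ i j, i ≠ j → d i * d j = 0 := by
      intro i j hij
      rcases snd_eq_zero_or_of_mem_grading (hx i) with hi | hi
      · rcases snd_eq_zero_or_of_mem_grading (hx j) with hj | hj
        · exact absurd ⟨i, j, hij, hi, hj⟩ hz
        · rw [hj.1, mul_zero]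
      · rw [hi.1, zero_mul]
    have e12 : ((-1 : ℤˣ)) ^ (1 * 2) = 1 := by decide
    have e30 : ((-1 : ℤˣ)) ^ (3 * 0) = 1 := by decide
    simp only [koszulChi_eq_sign hd, e12, e30, mul_one]
    rw [sum_sign_shuffle_one_three fun a b c => C.L3 (C.L1 (x a)) (x b) (x c),
      sum_sign_shuffle_two_three fun a b c => C.L2 (C.L2 (x a) (x b)) (x c), sum_shuffle_self,
      Equiv.Perm.sign_one, one_smul]
    have hs := h.skewBr_jacobi (x 0).2 (x 1).2 (x 2).2
    have hfst : ∀ i j, i ≠ j → (x i).2 = 0 → (x j).1 = 0 := fun i j hij hi =>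
      ((snd_eq_zero_or_of_mem_grading (hx j)).resolve_left fun hj => hz ⟨i, j, hij, hi, hj⟩).2
    -- The function component matters only when exactly one argument is a function, whose position
    -- gives three cases. The section component is `skewBr_jacobi`.
    refine Prod.ext ?_ ?_
    · have hcyc : ∀ X, IsCourantDorfman.cyc g.onSections C.D C.bracket 0 0 X = 0 := fun X => by
        simp [IsCourantDorfman.cyc, IsCourantDorfman.skewBr]
      have hcyc' : ∀ X, IsCourantDorfman.cyc g.onSections C.D C.bracket 0 X 0 = 0 := fun X => by
        simp [IsCourantDorfman.cyc, IsCourantDorfman.skewBr]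
      by_cases h0 : (x 0).2 = 0
      · have h1 := hfst 0 1 (by decide) h0
        have h2 := hfst 0 2 (by decide) h0
        simp [L1, L2, L3, h0, h1, h2, h.cyc_D_left, IsCourantDorfman.skewBr, h.pairing_bracket_D,
          h.pairing_D_D, h.pairing_comm (C.D _), hcyc]
        module
      by_cases h1 : (x 1).2 = 0
      · have h0 := hfst 1 0 (by decide) h1
        have h2 := hfst 1 2 (by decide) h1
        simp [L1, L2, L3, h0, h1, h2, h.cyc_D_left, IsCourantDorfman.skewBr, h.pairing_bracket_D,
          h.pairing_D_D, h.pairing_comm (C.D _), hcyc, hcyc']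
        module
      by_cases h2 : (x 2).2 = 0
      · have h0 := hfst 2 0 (by decide) h2
        have h1 := hfst 2 1 (by decide) h2
        simp [L1, L2, L3, h0, h1, h2, h.cyc_D_left, IsCourantDorfman.skewBr, h.pairing_bracket_D,
          h.pairing_D_D, h.pairing_comm (C.D _), hcyc']
        module
      have e : ∀ i, (x i).2 ≠ 0 → (x i).1 = 0 := fun i hi =>
        ((snd_eq_zero_or_of_mem_grading (hx i)).resolve_left hi).2
      simp [L1, L2, L3, e 0 h0, e 1 h1, e 2 h2, IsCourantDorfman.skewBr, IsCourantDorfman.cyc]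
    · simp only [L1, L2, L3, Prod.snd_add, Prod.snd_sub, Prod.snd_zero, map_smul, hs,
        Equiv.Perm.one_apply]
      module

theorem jacobi_four (d : Fin 4 → ℤ) (x : Fin 4 → LSpace EM F V)
    (hx : ∀ i, x i ∈ grading EM F V (d i)) :
    jacobiator C.structureMaps C.structureMaps d x = 0 := by
  have hL1 : C.L1 0 = 0 := by simp [L1]
  rw [jacobiator_four]
  simp only [hL1, smul_zero, Finset.sum_const_zero, zero_add, add_zero]
  by_cases hz : ∃ i, (x i).2 = 0
  · have key : ∀ σ : Equiv.Perm (Fin 4), (x (σ 0)).2 = 0 ∨ (x (σ 1)).2 = 0 ∨ (x (σ 2)).2 = 0 ∨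
        (x (σ 3)).2 = 0 := by
      intro σ
      obtain ⟨i, hi⟩ := hz
      rw [← σ.apply_symm_apply i] at hi
      generalize σ.symm i = i' at hi
      fin_cases i' <;> simp_all
    rw [Finset.sum_eq_zero, Finset.sum_eq_zero, add_zero]
    all_goals
      intro σ _
      refine (congrArg _ ?_).trans (smul_zero _)
      rcases key σ with e | e | e | e <;>
      simp [L2, L3, e, IsCourantDorfman.skewBr, IsCourantDorfman.cyc]
  push Not at hz
  have hd : ∀ i, d i = 0 ∧ (x i).1 = 0 := fun i =>
    (snd_eq_zero_or_of_mem_grading (hx i)).resolve_left (hz i)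
  have e22 : ((-1 : ℤˣ)) ^ (2 * 2) = 1 := by decide
  have e31 : ((-1 : ℤˣ)) ^ (3 * 1) = -1 := by decide
  have hd' : ∀ i j, i ≠ j → d i * d j = 0 := fun i j _ => by rw [(hd i).1, zero_mul]
  simp only [koszulChi_eq_sign hd', e22, e31,
    mul_one, mul_neg, Units.neg_smul, Finset.sum_neg_distrib]
  rw [sum_sign_shuffle_two_four fun a b c e => C.L3 (C.L2 (x a) (x b)) (x c) (x e),
    sum_sign_shuffle_three_four fun a b c e => C.L2 (C.L3 (x a) (x b) (x c)) (x e)]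
  have hj := h.cyc_jacobi (x 0).2 (x 1).2 (x 2).2 (x 3).2
  refine Prod.ext ?_ ?_
  · simp only [L2, L3, Prod.fst_add, Prod.fst_sub, Prod.fst_neg, Prod.fst_zero, map_smul, map_neg,
      map_zero, smul_zero, zero_sub, neg_smul, (hd _).2, smul_neg, neg_neg]
    -- The factor of `L3` is -1/6 = 2 · (-1/12), which accounts for the 2 in `cyc_jacobi`. In `L2`
    -- of `L3` a further -½ appears, since the function stands first, and the sign (-1)^(3·1) is
    -- negative.
    linear_combination (norm := module) (-(1 / 12 : ℝ)) • hj
  · simp [L2, L3, IsCourantDorfman.skewBr]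

theorem isLInfinityAlgebra : IsLInfinityAlgebra (grading EM F V) C.structureMaps where
  isInternal := isInternal_grading
  degree := structureMaps_mem_grading
  skew := structureMaps_skew h
  jacobi n hn d x hx := by
    match n, hn with
    | 1, _ => exact jacobi_one d x
    | 2, _ => exact jacobi_two h d x hx
    | 3, _ => exact jacobi_three h d x hx
    | 4, _ => exact jacobi_four h d x hx
    | n + 5, _ => exact jacobiator_eq_zero_of_five_le (by omega) d x

omit h in
-- Each summand is additive in the outer map, and additive in the inner one because the outer map is
-- additive in its first slot.
theorem jacobiator_add {L : Type*} [AddCommGroup L] [Module ℝ L]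
    {l l' m : ∀ k : ℕ, MultilinearMap ℝ (fun _ : Fin k => L) L} (hm : ∀ k, m k = l k + l' k)
    {n : ℕ} (d : Fin n → ℤ) (x : Fin n → L) :
    jacobiator m m d x = jacobiator l l d x + jacobiator l' l' d x +
      (jacobiator l l' d x + jacobiator l' l d x) := by
  simp only [jacobiator, ← Finset.sum_add_distrib, ← smul_add]
  refine Finset.sum_congr rfl fun a _ => Finset.sum_congr rfl fun σ _ => congrArg _ ?_
  rw [hm, hm, add_apply, add_apply, MultilinearMap.cons_add, MultilinearMap.cons_add]
  abel

end CourantAlgebroid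

end CourantJacobi

end

theorem mainTheorem9
    {EM : Type*} [NormedAddCommGroup EM] [NormedSpace ℝ EM] [FiniteDimensional ℝ EM]
    {M : Type*} [TopologicalSpace M] [T2Space M] [SecondCountableTopology M]
    [ChartedSpace EM M] [IsManifold 𝓘(ℝ, EM) ∞ M]
    {F : Type*} [NormedAddCommGroup F] [NormedSpace ℝ F] [FiniteDimensional ℝ F]
    {V : M → Type*} [TopologicalSpace (TotalSpace F V)] [∀ x, TopologicalSpace (V x)]
    [∀ x, AddCommGroup (V x)] [∀ x, Module ℝ (V x)]
    [FiberBundle F V] [VectorBundle ℝ F V] [ContMDiffVectorBundle ∞ F V 𝓘(ℝ, EM)]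
    (g : BundlePairing EM F V) (C C' : CourantAlgebroid g) (h : C.Compatible C') :
    IsCompatibleLInfinityAlgebra (CourantAlgebroid.grading EM F V)
      C.structureMaps C'.structureMaps := by
  have : CompleteSpace EM := FiniteDimensional.complete ℝ EM
  have hC := CourantAlgebroid.isLInfinityAlgebra C.isCourantDorfman
  have hC' := CourantAlgebroid.isLInfinityAlgebra C'.isCourantDorfman
  have hS := CourantAlgebroid.isLInfinityAlgebra (C.add C' h).isCourantDorfman
  refine ⟨hC, hC', fun n hn d x hx => ?_⟩
  -- In the expanded Jacobi identity of the sum, the two unmixed jacobiators vanish and the mixed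
  -- identity is left.
  have hj := hS.jacobi n hn d x hx
  rwa [CourantAlgebroid.jacobiator_add (C.structureMaps_add C' h), hC.jacobi n hn d x hx,
    hC'.jacobi n hn d x hx, add_zero, zero_add] at hj
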